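/- Let $f\colon I\to I$ be a densely chaotic interval map: $I=[a,b]\subset\mathbb R$ with $a\le b$, $f$ is continuous, and the set of pairs $(x,y)$ such that $$\limsup_{n\to+\infty}|f^n(x)-f^n(y)|>0\quad\text{and}\quad \liminf_{n\to+\infty}|f^n(x)-f^n(y)|=0$$ is dense in $I\times I$. Then: 1. $f^2=f\circ f$ has a horseshoe, that is, there exist two closed non degenerate intervals $J,K\subset I$ with disjoint interiors such that $J\cup K\subset f^2(J)\cap f^2(K)$; 2. the topological entropy of $f$ satisfies $h_{top}(f)\ge \frac{\log 2}{2}$; 3. $f$ is of type at most $6$ for Sharkovskiĭ's order $$3\lhd 5\lhd 7\lhd\cdots\lhd 2\cdot 3\lhd 2\cdot 5\lhd 2\cdot 7\lhd\cdots\lhd 2^2\cdot 3\lhd 2^2\cdot 5\lhd\cdots\lhd 2^3\lhd 2^2\lhd 2\lhd 1,$$ that is, there is a positive integer $n\unlhd 6$ such that the set of the (least) periods of the periodic points of $f$ is exactly $\{m\ge 1\mid n\unlhd m\}$. In particular, $f$ has a periodic point of (least) period $6$. -/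

import Mathlib

open Set Filter Function

/-- `(x, y)` is a Li-Yorke pair of modulus `δ` for `T`:
`limsup d(Tⁿ x, Tⁿ y) > δ` and `liminf d(Tⁿ x, Tⁿ y) = 0`. The upper and lower limits are taken in
`[0, ∞]`, so that they always have their usual meaning. -/
def IsLiYorkePairOfModulus {X : Type*} [MetricSpace X] (T : X → X) (δ : ℝ) (x y : X) : Prop :=
  ENNReal.ofReal δ < limsup (fun n : ℕ => edist (T^[n] x) (T^[n] y)) atTop ∧
    liminf (fun n : ℕ => edist (T^[n] x) (T^[n] y)) atTop = 0

/-- The set of Li-Yorke pairs of `T`, of any modulus `δ > 0`. -/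
def liYorkePairs {X : Type*} [MetricSpace X] (T : X → X) : Set (X × X) :=
  {p | ∃ δ : ℝ, 0 < δ ∧ IsLiYorkePairOfModulus T δ p.1 p.2}

/-- `T` is densely chaotic: the Li-Yorke pairs are dense in `X × X`. -/
def IsDenselyChaotic {X : Type*} [MetricSpace X] (T : X → X) : Prop :=
  Dense (liYorkePairs T)

/-- `g` has a horseshoe: there are two closed non degenerate subintervals `J = [c, d]` and
`K = [c', d']` with disjoint interiors such that `J ∪ K ⊆ g(J) ∩ g(K)`. -/
def HasHorseshoe {X : Type*} [LinearOrder X] [TopologicalSpace X] (g : X → X) : Prop :=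
  ∃ c d c' d' : X, c < d ∧ c' < d' ∧
    Disjoint (interior (Icc c d)) (interior (Icc c' d')) ∧
    Icc c d ∪ Icc c' d' ⊆ g '' Icc c d ∩ g '' Icc c' d'

/-- Sharkovskii's strict order `m ◁ n` on the positive integers,
`3 ◁ 5 ◁ 7 ◁ ⋯ ◁ 2·3 ◁ 2·5 ◁ ⋯ ◁ 2²·3 ◁ 2²·5 ◁ ⋯ ◁ 2³ ◁ 2² ◁ 2 ◁ 1`. -/
inductive SharkovskiiLT : ℕ → ℕ → Prop
  | same_exponent (a p q : ℕ) (hp : Odd p) (hq : Odd q) (h1 : 1 < p) (hpq : p < q) :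
      SharkovskiiLT (2 ^ a * p) (2 ^ a * q)
  | lower_exponent (a b p q : ℕ) (hab : a < b) (hp : Odd p) (hq : Odd q) (h1p : 1 < p)
      (h1q : 1 < q) : SharkovskiiLT (2 ^ a * p) (2 ^ b * q)
  | power_of_two (a b p : ℕ) (hp : Odd p) (h1 : 1 < p) : SharkovskiiLT (2 ^ a * p) (2 ^ b)
  | powers_of_two (a b : ℕ) (hab : b < a) : SharkovskiiLT (2 ^ a) (2 ^ b)

/-- Sharkovskii's order `m ⊴ n`, for positive integers `m` and `n`. -/
def SharkovskiiLE (m n : ℕ) : Prop := m = n ∨ SharkovskiiLT m n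

/-- The set of the (least) periods of the periodic points of `f`. -/
def periodSet {X : Type*} (f : X → X) : Set ℕ :=
  {m | 0 < m ∧ ∃ x : X, minimalPeriod f x = m}

/-- `f` is of type `n` for Sharkovskii's order, `n` a positive integer: the set of the periods of
its periodic points is `{m | n ⊴ m}`. -/
def IsOfSharkovskiiType {X : Type*} (f : X → X) (n : ℕ) : Prop :=
  0 < n ∧ periodSet f = {m | 0 < m ∧ SharkovskiiLE n m}

/-- `f` is of type at most `k` for Sharkovskii's order, where `k` is a positive integer which is not
a power of two. The only type that is not a positive integer, `2^∞`, lies above all such `k`. -/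
def IsOfSharkovskiiTypeAtMost {X : Type*} (f : X → X) (k : ℕ) : Prop :=
  ∃ n : ℕ, SharkovskiiLE n k ∧ IsOfSharkovskiiType f n

/-! Replace `f` by a continuous `F : ℝ → ℝ` with values in `[a, b]`, and suppose that `F^[2]`, hence
also `F`, has no horseshoe. Then a fixed point that repels on one side has an invariant interval
strictly on that side (`exists_invariant_right`). Two invariant intervals at positive distance would
give a whole box without proximal pairs (`DenseLiYorke.not_disjoint`), so each of `F` and `F^[2]`
can cross the diagonal only downwards, at points `z` and `w` (`DenseLiYorke.exists_crossing`). If `z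
≠ w`, there are again two invariant intervals for `F^[2]`, or a nondegenerate interval on which `F`
is constant or all orbits converge (`DenseLiYorke.not_crossing_lt`). If `z = w`, the terms of an
orbit on the left of `z` increase and those on the right decrease, so every orbit of `F^[2]`
converges (`exists_tendsto_even_iterate`). Either way some box has no Li-Yorke pair.

The rest uses only the horseshoe of `F^[2]`. For the entropy, `n` pullbacks give `2 ^ n` intervals
with disjoint interiors; keeping every other one makes them disjoint, and the lost factor `2`
disappears in the limit. For the periods, a loop of length three through the horseshoe gives `F^[2]`
a point of period three. A cycle of odd length `m ≥ 3` forces all larger periods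
(`exists_period_of_odd`), and any longer cycle than a fixed point forces period two
(`exists_period_two`). So `F` has all even periods, and its type is its least odd period above `1`,
or `6` if there is none. -/

/-- A horseshoe of a real map, with the two intervals in increasing order. -/
def RealHorseshoe (F : ℝ → ℝ) : Prop :=
  ∃ c d c' d' : ℝ, c < d ∧ d ≤ c' ∧ c' < d' ∧
    Icc c d ∪ Icc c' d' ⊆ F '' Icc c d ∩ F '' Icc c' d'

/-! ### Mirror symmetry and horseshoes -/

/-- The map `F` seen through the reflection `x ↦ -x`. -/
def reflect (F : ℝ → ℝ) : ℝ → ℝ := fun x => -F (-x)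

theorem reflect_iterate (F : ℝ → ℝ) (n : ℕ) (x : ℝ) :
    (reflect F)^[n] x = -F^[n] (-x) := by
  induction n generalizing x with
  | zero => simp
  | succ n ih => rw [iterate_succ_apply, ih, iterate_succ_apply]; simp [reflect]

theorem reflect_iterate_eq (F : ℝ → ℝ) (n : ℕ) : reflect (F^[n]) = (reflect F)^[n] := by
  funext x; rw [reflect_iterate]; rfl

theorem Continuous.reflect {F : ℝ → ℝ} (hF : Continuous F) : Continuous (reflect F) := by
  unfold _root_.reflect; fun_prop

theorem reflect_mem_Icc {F : ℝ → ℝ} {a b : ℝ} (hb : ∀ x, F x ∈ Icc a b) (x : ℝ) :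
    reflect F x ∈ Icc (-b) (-a) :=
  ⟨neg_le_neg (hb _).2, neg_le_neg (hb _).1⟩

theorem image_reflect_Icc (F : ℝ → ℝ) {c d x : ℝ} (h : x ∈ reflect F '' Icc c d) :
    -x ∈ F '' Icc (-d) (-c) := by
  obtain ⟨t, ht, rfl⟩ := h
  exact ⟨-t, ⟨neg_le_neg ht.2, neg_le_neg ht.1⟩, by simp [reflect]⟩

theorem RealHorseshoe.of_reflect {F : ℝ → ℝ} (h : RealHorseshoe (reflect F)) :
    RealHorseshoe F := by
  obtain ⟨c, d, c', d', h1, h2, h3, h4⟩ := h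
  refine ⟨-d', -c', -d, -c, by linarith, by linarith, by linarith, ?_⟩
  intro x hx
  have hx' : -x ∈ Icc c d ∪ Icc c' d' := by
    rcases hx with hx | hx
    · right; constructor <;> linarith [hx.1, hx.2]
    · left; constructor <;> linarith [hx.1, hx.2]
  obtain ⟨hl, hr⟩ := h4 hx'
  have hl' := image_reflect_Icc F hl
  have hr' := image_reflect_Icc F hr
  rw [neg_neg] at hl' hr'
  exact ⟨hr', hl'⟩

theorem RealHorseshoe.iterate_two {F : ℝ → ℝ} (h : RealHorseshoe F) :
    RealHorseshoe F^[2] := by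
  obtain ⟨c, d, c', d', h1, h2, h3, h4⟩ := h
  refine ⟨c, d, c', d', h1, h2, h3, fun x hx => ?_⟩
  obtain ⟨⟨y, hy, rfl⟩, -⟩ := h4 hx
  obtain ⟨⟨s, hs, hs'⟩, t, ht, ht'⟩ := h4 (Or.inl hy)
  exact ⟨⟨s, hs, by simp [hs']⟩, t, ht, by simp [ht']⟩

/-! ### Invariant intervals next to a repelling fixed point -/

theorem Icc_subset_image {F : ℝ → ℝ} (hF : Continuous F) {c d s t : ℝ} (hcd : c ≤ d)
    (h : F c ≤ s ∧ t ≤ F d ∨ F d ≤ s ∧ t ≤ F c) : Icc s t ⊆ F '' Icc c d := by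
  rcases h with ⟨h1, h2⟩ | ⟨h1, h2⟩
  · exact (Icc_subset_Icc h1 h2).trans (intermediate_value_Icc hcd hF.continuousOn)
  · exact (Icc_subset_Icc h1 h2).trans (intermediate_value_Icc' hcd hF.continuousOn)

/-- The left end is the smaller of `y` and the minimum of `F` on `[y, M]`: points up to `y` move to
the right, and points beyond `y` land above the minimum. -/
theorem exists_invariant_of_lt {F : ℝ → ℝ} (hF : Continuous F) {c y M : ℝ} (hcy : c < y)
    (hyM : y < M) (hU : ∀ t ∈ Ioc c y, t < F t) (hM : ∀ t ∈ Icc c M, F t ≤ M)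
    (hc : ∀ t ∈ Ioc c M, c < F t) :
    ∃ c', c < c' ∧ c' < M ∧ MapsTo F (Icc c' M) (Icc c' M) := by
  obtain ⟨t₀, ht₀, hmin⟩ := isCompact_Icc.exists_isMinOn (nonempty_Icc.2 hyM.le)
    (hF.continuousOn (s := Icc y M))
  refine ⟨min (F t₀) y, lt_min (hc _ ⟨hcy.trans_le ht₀.1, ht₀.2⟩) hcy,
    (min_le_right _ _).trans_lt hyM, fun t ht => ?_⟩
  have hct : c < t := (lt_min (hc _ ⟨hcy.trans_le ht₀.1, ht₀.2⟩) hcy).trans_le ht.1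
  refine ⟨?_, hM t ⟨hct.le, ht.2⟩⟩
  rcases le_total t y with h | h
  · exact ht.1.trans (hU t ⟨hct, h⟩).le
  · exact (min_le_left _ _).trans (hmin ⟨h, ht.2⟩)

/-- Without a horseshoe, a fixed point that repels on its right can be cut off: there is an
invariant interval strictly on its right. -/
theorem exists_invariant_right {F : ℝ → ℝ} (hF : Continuous F) {a b c y : ℝ}
    (hb : ∀ x, F x ∈ Icc a b) (hns : ¬ RealHorseshoe F) (hc : F c = c) (hcy : c < y)
    (hU : ∀ t ∈ Ioc c y, t < F t) :
    ∃ c' M, c < c' ∧ c' < M ∧ M ≤ b ∧ MapsTo F (Icc c' M) (Icc c' M) := by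
  have hyF : y < F y := hU y ⟨hcy, le_rfl⟩
  by_cases h : ∀ t, c < t → c < F t
  · obtain ⟨c', h1, h2, h3⟩ := exists_invariant_of_lt hF hcy (hyF.trans_le (hb y).2) hU
      (fun t _ => (hb t).2) (fun t ht => h t ht.1)
    exact ⟨c', b, h1, h2, le_rfl, h3⟩
  push Not at h
  obtain ⟨t₁, ht₁, ht₁'⟩ := h
  let S : Set ℝ := {t | y ≤ t ∧ F t ≤ c}
  have hSc : IsClosed S :=
    (isClosed_le continuous_const continuous_id).inter (isClosed_le hF continuous_const)
  have hne : S.Nonempty := by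
    refine ⟨t₁, ?_, ht₁'⟩
    by_contra hlt
    have := hU t₁ ⟨ht₁, (not_le.1 hlt).le⟩
    linarith
  have hbd : BddBelow S := ⟨y, fun t ht => ht.1⟩
  -- `w` is the first point beyond `y` that returns to `c` or below. If some `x` in `[c, w]` reached
  -- `w`, then `[c, x]` and `[x, w]` would form a horseshoe; so the maximum of `F` on `[c, w]` is
  -- below `w`, and it serves as the right end.
  obtain ⟨w, hw⟩ : ∃ w, w = sInf S := ⟨_, rfl⟩
  have hwS : w ∈ S := hw ▸ hSc.csInf_mem hne hbd
  have hpos : ∀ t, c < t → t < w → c < F t := by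
    intro t h1 h2
    by_contra h3
    rcases le_total t y with h4 | h4
    · have := hU t ⟨h1, h4⟩
      linarith
    · have : w ≤ t := hw ▸ csInf_le hbd ⟨h4, not_lt.1 h3⟩
      linarith
  have hcw : c < w := hcy.trans_le hwS.1
  have hmax : ∀ x ∈ Icc c w, F x < w := by
    intro x hx
    by_contra hxw
    rw [not_lt] at hxw
    have h1 : c < x := lt_of_le_of_ne hx.1 (by rintro rfl; linarith)
    have h2 : x < w := lt_of_le_of_ne hx.2 (by rintro rfl; linarith [hwS.2])
    refine hns ⟨c, x, x, w, h1, le_rfl, h2, ?_⟩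
    have : Icc c x ∪ Icc x w ⊆ Icc c w :=
      union_subset (Icc_subset_Icc le_rfl hx.2) (Icc_subset_Icc hx.1 le_rfl)
    refine this.trans (subset_inter (Icc_subset_image hF hx.1 ?_) (Icc_subset_image hF hx.2 ?_))
    · exact Or.inl ⟨hc.le, hxw⟩
    · exact Or.inr ⟨hwS.2, hxw⟩
  obtain ⟨x₀, hx₀, hmx⟩ := isCompact_Icc.exists_isMaxOn (nonempty_Icc.2 hcw.le)
    (hF.continuousOn (s := Icc c w))
  have hMw := hmax x₀ hx₀
  have hyM : y < F x₀ := hyF.trans_le (hmx ⟨hcy.le, hwS.1⟩)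
  obtain ⟨c', h1, h2, h3⟩ := exists_invariant_of_lt hF hcy hyM hU
    (fun t ht => hmx ⟨ht.1, ht.2.trans hMw.le⟩) (fun t ht => hpos t ht.1 (ht.2.trans_lt hMw))
  exact ⟨c', F x₀, h1, h2, (hb _).2, h3⟩

/-- Mirror image of `exists_invariant_right`. -/
theorem exists_invariant_left {F : ℝ → ℝ} (hF : Continuous F) {a b c y : ℝ}
    (hb : ∀ x, F x ∈ Icc a b) (hns : ¬ RealHorseshoe F) (hc : F c = c) (hcy : y < c)
    (hU : ∀ t ∈ Ico y c, F t < t) :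
    ∃ M c', a ≤ M ∧ M < c' ∧ c' < c ∧ MapsTo F (Icc M c') (Icc M c') := by
  obtain ⟨c', M, h1, h2, h3, h4⟩ := exists_invariant_right hF.reflect (reflect_mem_Icc hb)
    (fun h => hns h.of_reflect) (c := -c) (y := -y) (by simp [reflect, hc]) (by linarith)
    (fun t ht => by
      have := hU (-t) ⟨by linarith [ht.2], by linarith [ht.1]⟩
      simp only [reflect]; linarith)
  refine ⟨-M, -c', by linarith, by linarith, by linarith, fun t ht => ?_⟩
  have := h4 (x := -t) ⟨by linarith [ht.2], by linarith [ht.1]⟩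
  simp only [reflect, neg_neg] at this
  exact ⟨by linarith [this.2], by linarith [this.1]⟩

/-! ### Li-Yorke pairs -/

/-- Li-Yorke pairs: proximal but not asymptotic. -/
def LiYorke (F : ℝ → ℝ) (x y : ℝ) : Prop :=
  (∀ ε > 0, ∃ᶠ n in atTop, |F^[n] x - F^[n] y| < ε) ∧
    ¬ Tendsto (fun n => F^[n] x - F^[n] y) atTop (nhds 0)

/-- Every box in `[a, b] × [a, b]` contains a Li-Yorke pair. -/
def DenseLiYorke (a b : ℝ) (F : ℝ → ℝ) : Prop :=
  ∀ s t s' t', a ≤ s → s < t → t ≤ b → a ≤ s' → s' < t' → t' ≤ b →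
    ∃ x ∈ Icc s t, ∃ y ∈ Icc s' t', LiYorke F x y

theorem LiYorke.reflect {F : ℝ → ℝ} {x y : ℝ} (h : LiYorke F x y) :
    LiYorke (reflect F) (-x) (-y) := by
  refine ⟨fun ε hε => (h.1 ε hε).mono fun n hn => ?_, fun ht => h.2 ?_⟩
  · rw [reflect_iterate, reflect_iterate, neg_neg, neg_neg, ← abs_neg]
    convert hn using 2; ring
  · have := ht.neg
    simp only [reflect_iterate, neg_neg, neg_zero] at this
    convert this using 2; ring

theorem DenseLiYorke.reflect {a b : ℝ} {F : ℝ → ℝ} (h : DenseLiYorke a b F) :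
    DenseLiYorke (-b) (-a) (reflect F) := by
  intro s t s' t' h1 h2 h3 h4 h5 h6
  obtain ⟨x, hx, y, hy, hxy⟩ := h (-t) (-s) (-t') (-s') (by linarith) (by linarith) (by linarith)
    (by linarith) (by linarith) (by linarith)
  exact ⟨-x, ⟨by linarith [hx.2], by linarith [hx.1]⟩, -y,
    ⟨by linarith [hy.2], by linarith [hy.1]⟩, hxy.reflect⟩

theorem LiYorke.not_tendsto {F : ℝ → ℝ} {x y p q : ℝ} (h : LiYorke F x y)
    (hx : Tendsto (fun n => F^[n] x) atTop (nhds p))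
    (hy : Tendsto (fun n => F^[n] y) atTop (nhds q)) : False := by
  have hd := hx.sub hy
  have hpq : p = q := by
    by_contra hne
    have hpos : 0 < |p - q| / 2 := by have := abs_pos.2 (sub_ne_zero.2 hne); linarith
    have hev := hd.abs.eventually_const_lt (u := |p - q| / 2) (by linarith)
    obtain ⟨n, h1, h2⟩ := ((h.1 _ hpos).and_eventually hev).exists
    linarith
  rw [hpq, sub_self] at hd
  exact h.2 hd

theorem Continuous.tendsto_sub_of_mem_Icc {F : ℝ → ℝ} {a b : ℝ} (hF : Continuous F)
    {x y : ℕ → ℝ} {l : Filter ℕ} (hx : ∀ᶠ n in l, x n ∈ Icc a b)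
    (hy : ∀ᶠ n in l, y n ∈ Icc a b) (h : Tendsto (fun n => x n - y n) l (nhds 0)) :
    Tendsto (fun n => F (x n) - F (y n)) l (nhds 0) := by
  have hu := (isCompact_Icc (a := a) (b := b)).uniformContinuousOn_of_continuous hF.continuousOn
  rw [Metric.uniformContinuousOn_iff] at hu
  rw [Metric.tendsto_nhds] at h ⊢
  intro ε hε
  obtain ⟨δ, hδ, hu⟩ := hu ε hε
  filter_upwards [h δ hδ, hx, hy] with n h1 h2 h3
  have := hu _ h2 _ h3 (by simpa [Real.dist_eq] using h1)
  simpa [Real.dist_eq] using this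

theorem iterate_mem_Icc {F : ℝ → ℝ} {a b : ℝ} (hb : ∀ x, F x ∈ Icc a b) (x : ℝ) :
    ∀ n : ℕ, 1 ≤ n → F^[n] x ∈ Icc a b := by
  intro n hn
  obtain ⟨m, rfl⟩ := Nat.exists_eq_add_of_le' hn
  rw [iterate_succ_apply']
  exact hb _

/-- By uniform continuity on `[a, b]`, closeness at an odd time survives one more application of
`F`, and convergence along even times carries over to odd times. -/
theorem LiYorke.iterate_two {F : ℝ → ℝ} {a b : ℝ} (hF : Continuous F)
    (hb : ∀ x, F x ∈ Icc a b) {x y : ℝ} (h : LiYorke F x y) : LiYorke F^[2] x y := by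
  have hmem : ∀ z : ℝ, ∀ᶠ n : ℕ in atTop, F^[n] z ∈ Icc a b := fun z =>
    (eventually_ge_atTop 1).mono fun n hn => iterate_mem_Icc hb z n hn
  constructor
  · intro ε hε
    have hu := (isCompact_Icc (a := a) (b := b)).uniformContinuousOn_of_continuous
      hF.continuousOn
    rw [Metric.uniformContinuousOn_iff] at hu
    obtain ⟨δ, hδ, hu⟩ := hu ε hε
    rw [frequently_atTop]
    intro N
    obtain ⟨n, hn, h1⟩ := frequently_atTop.1 (h.1 (min δ ε) (lt_min hδ hε)) (2 * N + 1)
    rcases Nat.even_or_odd' n with ⟨m, rfl | rfl⟩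
    · refine ⟨m, by omega, ?_⟩
      rw [← iterate_mul]
      exact h1.trans_le (min_le_right _ _)
    · refine ⟨m + 1, by omega, ?_⟩
      rw [← iterate_mul, show 2 * (m + 1) = (2 * m + 1) + 1 by ring, iterate_succ_apply' F (2 * m + 1),
        iterate_succ_apply' F (2 * m + 1)]
      exact hu _ (iterate_mem_Icc hb _ _ (by omega)) _ (iterate_mem_Icc hb _ _ (by omega))
        (h1.trans_le (min_le_left _ _))
  · intro ht
    apply h.2
    have he : Tendsto (fun n => F^[2 * n] x - F^[2 * n] y) atTop (nhds 0) := by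
      simpa only [iterate_mul] using ht
    have ho : Tendsto (fun n => F^[2 * n + 1] x - F^[2 * n + 1] y) atTop (nhds 0) := by
      simp only [iterate_succ_apply']
      have hm : Tendsto (fun n : ℕ => 2 * n) atTop atTop :=
        tendsto_atTop_mono (fun n => by simp only [id]; omega) tendsto_id
      exact hF.tendsto_sub_of_mem_Icc (hm.eventually (hmem x)) (hm.eventually (hmem y)) he
    rw [Metric.tendsto_atTop] at he ho ⊢
    intro ε hε
    obtain ⟨N, hN⟩ := he ε hε
    obtain ⟨N', hN'⟩ := ho ε hε
    refine ⟨2 * (N + N') + 1, fun n hn => ?_⟩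
    rcases Nat.even_or_odd' n with ⟨m, rfl | rfl⟩
    · exact hN m (by omega)
    · exact hN' m (by omega)

theorem DenseLiYorke.iterate_two {F : ℝ → ℝ} {a b : ℝ} (hF : Continuous F)
    (hb : ∀ x, F x ∈ Icc a b) (h : DenseLiYorke a b F) : DenseLiYorke a b F^[2] := by
  intro s t s' t' h1 h2 h3 h4 h5 h6
  obtain ⟨x, hx, y, hy, hxy⟩ := h s t s' t' h1 h2 h3 h4 h5 h6
  exact ⟨x, hx, y, hy, hxy.iterate_two hF hb⟩

theorem DenseLiYorke.not_disjoint {F : ℝ → ℝ} {a b s t s' t' : ℝ} (h : DenseLiYorke a b F)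
    (h1 : a ≤ s) (h2 : s < t) (h3 : t < s') (h4 : s' < t') (h5 : t' ≤ b)
    (hm : MapsTo F (Icc s t) (Icc s t)) (hm' : MapsTo F (Icc s' t') (Icc s' t')) : False := by
  obtain ⟨x, hx, y, hy, hxy⟩ := h s t s' t' h1 h2 (by linarith) (by linarith) h4 h5
  obtain ⟨n, hn⟩ := (hxy.1 (s' - t) (by linarith)).exists
  have hx' := hm.iterate n hx
  have hy' := hm'.iterate n hy
  rw [abs_lt] at hn
  linarith [hx'.2, hy'.1]

/-! ### Crossing the diagonal -/

theorem exists_last_fixed {F : ℝ → ℝ} (hF : Continuous F) {x y : ℝ} (hxy : x ≤ y)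
    (hx : F x ≤ x) (hy : y < F y) :
    ∃ c, x ≤ c ∧ c < y ∧ F c = c ∧ ∀ t ∈ Ioc c y, t < F t := by
  let S : Set ℝ := {t | F t ≤ t ∧ t ≤ y}
  have hSc : IsClosed S :=
    (isClosed_le hF continuous_id).inter (isClosed_le continuous_id continuous_const)
  have hSb : BddAbove S := ⟨y, fun t ht => ht.2⟩
  obtain ⟨c, hcdef⟩ : ∃ c, c = sSup S := ⟨_, rfl⟩
  have hcS : c ∈ S := hcdef ▸ hSc.csSup_mem ⟨x, hx, hxy⟩ hSb
  have hcy : c < y := lt_of_le_of_ne hcS.2 (by rintro rfl; linarith [hcS.1])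
  have hU : ∀ t ∈ Ioc c y, t < F t := by
    intro t ht
    by_contra hh
    have : t ≤ c := hcdef ▸ le_csSup hSb ⟨not_lt.1 hh, ht.2⟩
    linarith [ht.1]
  refine ⟨c, hcdef ▸ le_csSup hSb ⟨hx, hxy⟩, hcy, le_antisymm hcS.1 ?_, hU⟩
  have hcl : IsClosed {t | t ≤ F t} := isClosed_le continuous_id hF
  have : closure (Ioc c y) ⊆ {t | t ≤ F t} := hcl.closure_subset_iff.2 fun t ht => (hU t ht).le
  exact this (by rw [closure_Ioc hcy.ne]; exact ⟨le_rfl, hcy.le⟩)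

theorem exists_first_fixed {F : ℝ → ℝ} (hF : Continuous F) {x y : ℝ} (hxy : x ≤ y)
    (hx : F x < x) (hy : y ≤ F y) :
    ∃ c, x < c ∧ c ≤ y ∧ F c = c ∧ ∀ t ∈ Ico x c, F t < t := by
  obtain ⟨c, h1, h2, h3, h4⟩ := exists_last_fixed hF.reflect (neg_le_neg hxy)
    (by simpa [reflect] using hy) (by simpa [reflect] using hx)
  refine ⟨-c, by linarith, by linarith, by simp only [reflect] at h3; linarith, fun t ht => ?_⟩
  have := h4 (-t) ⟨by linarith [ht.2], by linarith [ht.1]⟩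
  simp only [reflect, neg_neg] at this
  linarith

/-- A densely chaotic map without a horseshoe crosses the diagonal downwards. -/
theorem DenseLiYorke.exists_crossing {F : ℝ → ℝ} {a b : ℝ} (hF : Continuous F)
    (hb : ∀ x, F x ∈ Icc a b) (h : DenseLiYorke a b F) (hns : ¬ RealHorseshoe F) :
    ∃ z, (∀ x ≤ z, x ≤ F x) ∧ ∀ x, z ≤ x → F x ≤ x := by
  have key : ∀ x y, x < y → F x < x → F y ≤ y := by
    intro x y hxy hx
    by_contra! hy
    obtain ⟨c, hxc, hcy, hc, hU⟩ := exists_last_fixed hF hxy.le hx.le hy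
    obtain ⟨d, hxd, hdc, hd, hD⟩ := exists_first_fixed hF hxc hx hc.ge
    obtain ⟨c', M, i1, i2, i3, i4⟩ := exists_invariant_right hF hb hns hc hcy hU
    obtain ⟨M', d', j1, j2, j3, j4⟩ := exists_invariant_left hF hb hns hd hxd hD
    exact h.not_disjoint j1 j2 (by linarith) i2 i3 j4 i4
  let U : Set ℝ := {x | x < F x}
  have hne : U.Nonempty := ⟨a - 1, by have := (hb (a - 1)).1; exact lt_of_lt_of_le (by linarith) this⟩
  have hbd : BddAbove U := ⟨b, fun x hx => (le_of_lt hx).trans (hb x).2⟩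
  have hlt : ∀ x, x < sSup U → x ≤ F x := by
    intro x hx
    obtain ⟨u, hu, hxu⟩ := exists_lt_of_lt_csSup hne hx
    by_contra! hh
    exact absurd (key x u hxu hh) (not_le.2 hu)
  have hgt : ∀ x, sSup U < x → F x ≤ x := by
    intro x hx
    by_contra! hh
    exact absurd (le_csSup hbd hh) (not_le.2 hx)
  refine ⟨sSup U, fun x hx => ?_, fun x hx => ?_⟩
  · have hcl : IsClosed {t | t ≤ F t} := isClosed_le continuous_id hF
    have : closure (Iio (sSup U)) ⊆ {t | t ≤ F t} := hcl.closure_subset_iff.2 hlt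
    rw [closure_Iio] at this
    exact this hx
  · have hcl : IsClosed {t | F t ≤ t} := isClosed_le hF continuous_id
    have : closure (Ioi (sSup U)) ⊆ {t | F t ≤ t} := hcl.closure_subset_iff.2 hgt
    rw [closure_Ioi] at this
    exact this hx

theorem DenseLiYorke.not_forall_tendsto {F : ℝ → ℝ} {a b s t : ℝ} (h : DenseLiYorke a b F)
    (h1 : a ≤ s) (h2 : s < t) (h3 : t ≤ b)
    (hc : ∀ x ∈ Icc s t, ∃ p, Tendsto (fun n => F^[n] x) atTop (nhds p)) : False := by
  obtain ⟨x, hx, y, hy, hxy⟩ := h s t s t h1 h2 h3 h1 h2 h3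
  obtain ⟨p, hp⟩ := hc x hx
  obtain ⟨q, hq⟩ := hc y hy
  exact hxy.not_tendsto hp hq

theorem DenseLiYorke.not_const {F : ℝ → ℝ} {a b s t m : ℝ} (h : DenseLiYorke a b F)
    (h1 : a ≤ s) (h2 : s < t) (h3 : t ≤ b) (hc : ∀ x ∈ Icc s t, F x = m) : False := by
  obtain ⟨x, hx, y, hy, hxy⟩ := h s t s t h1 h2 h3 h1 h2 h3
  refine hxy.2 (tendsto_const_nhds.congr' ?_)
  filter_upwards [eventually_ge_atTop 1] with n hn
  obtain ⟨m, rfl⟩ := Nat.exists_eq_add_of_le' hn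
  rw [iterate_succ_apply, iterate_succ_apply, hc x hx, hc y hy, sub_self]

/-- Between `z` and `w` the map `F^[2]` moves some point to the right, which yields an
`F^[2]`-invariant interval beyond `z`. Its image under `F` is also `F^[2]`-invariant and misses `z`,
and each side of `z` is impossible for it. -/
theorem DenseLiYorke.not_crossing_lt {F : ℝ → ℝ} {a b z w : ℝ} (hF : Continuous F)
    (hb : ∀ x, F x ∈ Icc a b) (h : DenseLiYorke a b F) (hns : ¬ RealHorseshoe F^[2])
    (hz1 : ∀ x ≤ z, x ≤ F x) (hz2 : ∀ x, z ≤ x → F x ≤ x)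
    (hw1 : ∀ x ≤ w, x ≤ F^[2] x) (hw2 : ∀ x, w ≤ x → F^[2] x ≤ x) : ¬ z < w := by
  intro hzw
  have hz : F z = z := le_antisymm (hz2 z le_rfl) (hz1 z le_rfl)
  have hw : F^[2] w = w := le_antisymm (hw2 w le_rfl) (hw1 w le_rfl)
  have hgz : F^[2] z = z := by simp [hz]
  have hza : a ≤ z := hz ▸ (hb z).1
  have hwb : w ≤ b := hw ▸ (hb (F w)).2
  have hg := hF.iterate 2
  have hbg : ∀ x, F^[2] x ∈ Icc a b := fun x => hb (F x)
  have h2 := h.iterate_two hF hb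
  -- Otherwise `F^[2]` is the identity on `(z, w)`, and its orbits there are constant.
  obtain ⟨y, hzy, hyw, hy⟩ : ∃ y, z < y ∧ y < w ∧ y < F^[2] y := by
    by_contra! hcon
    obtain ⟨s, hs1, hs2⟩ := exists_between hzw
    obtain ⟨t, ht1, ht2⟩ := exists_between hs2
    refine h2.not_forall_tendsto (hza.trans hs1.le) ht1 (ht2.le.trans hwb) fun x hx => ⟨x, ?_⟩
    have hfix : IsFixedPt F^[2] x := le_antisymm (hcon x (by linarith [hx.1]) (by linarith [hx.2]))
      (hw1 x (by linarith [hx.2]))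
    simp only [fun n => (hfix.iterate n).eq]
    exact tendsto_const_nhds
  obtain ⟨c, hzc, hcy, hc, hU⟩ := exists_last_fixed hg hzy.le hgz.le hy
  obtain ⟨c', M, i1, i2, i3, i4⟩ := exists_invariant_right hg hbg hns hc hcy hU
  have himg := hF.continuousOn.image_Icc (a := c') (b := M) i2.le
  set m := sInf (F '' Icc c' M) with hm
  set m' := sSup (F '' Icc c' M) with hm'
  have hmm : m ≤ m' := by
    have : (Icc m m').Nonempty := himg ▸ (nonempty_Icc.2 i2.le).image F
    exact nonempty_Icc.1 this
  have hznot : z ∉ F '' Icc c' M := by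
    rintro ⟨t, ht, htz⟩
    have := i4 ht
    have hgt : F^[2] t = z := by simp [htz, hz]
    rw [hgt] at this
    linarith [this.1]
  have hinv : MapsTo F^[2] (Icc m m') (Icc m m') := by
    rw [← himg]
    rintro _ ⟨t, ht, rfl⟩
    exact ⟨F^[2] t, i4 ht, rfl⟩
  have hmem : m ∈ F '' Icc c' M ∧ m' ∈ F '' Icc c' M := by
    rw [himg]; exact ⟨left_mem_Icc.2 hmm, right_mem_Icc.2 hmm⟩
  have hma : a ≤ m := by
    obtain ⟨t, -, ht⟩ := hmem.1
    exact ht ▸ (hb t).1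
  have hac : a ≤ c' := by linarith
  rcases lt_or_ge m' z with hlt | hge
  · rcases hmm.eq_or_lt with heq | hmlt
    · refine h.not_const hac i2 i3 (m := m) fun x hx => ?_
      have : F x ∈ Icc m m' := himg ▸ mem_image_of_mem F hx
      exact le_antisymm (heq ▸ this.2) this.1
    · exact h2.not_disjoint hma hmlt (by linarith) i2 i3 hinv i4
  · have hzm : z < m := by
      by_contra hh
      exact hznot (himg ▸ ⟨not_lt.1 hh, hge⟩)
    -- With the image on the right of `z`, whole orbits stay there, where `F` moves points to the
    -- left: they decrease and are bounded below by `z`.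
    refine h.not_forall_tendsto hac i2 i3 fun x hx => ?_
    have hT : MapsTo F (Icc c' M ∪ F '' Icc c' M) (Icc c' M ∪ F '' Icc c' M) := by
      rintro t (ht | ⟨t, ht, rfl⟩)
      · exact Or.inr ⟨t, ht, rfl⟩
      · exact Or.inl (i4 ht)
    have hgt : ∀ n, z < F^[n] x := by
      intro n
      rcases hT.iterate n (Or.inl hx) with h' | h'
      · linarith [h'.1]
      · rw [himg] at h'; linarith [h'.1]
    refine ⟨_, tendsto_atTop_ciInf (antitone_nat_of_succ_le fun n => ?_)
      ⟨z, by rintro _ ⟨n, rfl⟩; exact (hgt n).le⟩⟩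
    rw [iterate_succ_apply']
    exact hz2 _ (hgt n).le

/-! ### Orbits around a common crossing point of `F` and `F^[2]` -/

/-- While the orbit is beyond `z`, it remains below a value `F t` with `t` in `[x, z]`. By the
intermediate value theorem the current term is then `F t'` with `t'` in `[t, z]`, so the next term
is `F^[2] t'`, which is at least `t'` and hence at least `x`. -/
theorem le_iterate_of_crossing {F : ℝ → ℝ} {z : ℝ} (hF : Continuous F)
    (hz1 : ∀ x ≤ z, x ≤ F x) (hz2 : ∀ x, z ≤ x → F x ≤ x)
    (hg : ∀ x ≤ z, x ≤ F^[2] x) {x : ℝ} (hx : x ≤ z) (n : ℕ) : x ≤ F^[n] x := by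
  have hz : F z = z := le_antisymm (hz2 z le_rfl) (hz1 z le_rfl)
  suffices x ≤ F^[n] x ∧ (z < F^[n] x → ∃ t, x ≤ t ∧ t ≤ z ∧ F^[n] x ≤ F t) from this.1
  induction n with
  | zero => exact ⟨le_rfl, fun h => absurd hx (not_le.2 h)⟩
  | succ n ih =>
    rw [iterate_succ_apply']
    rcases le_or_gt (F^[n] x) z with h | h
    · exact ⟨ih.1.trans (hz1 _ h), fun _ => ⟨_, ih.1, h, le_rfl⟩⟩
    · obtain ⟨t, ht1, ht2, ht3⟩ := ih.2 h
      obtain ⟨t', ht', hFt'⟩ := Icc_subset_image hF ht2 (Or.inr ⟨hz.le, le_rfl⟩) ⟨h.le, ht3⟩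
      refine ⟨?_, fun _ => ⟨t, ht1, ht2, (hz2 _ h.le).trans ht3⟩⟩
      have := hg t' ht'.2
      rw [iterate_succ_apply, iterate_one, hFt'] at this
      linarith [ht'.1]

/-- A sequence that stays to the right of each of its terms on the left of `z` converges along
its terms on the left of `z`. -/
theorem tendsto_left_terms {u : ℕ → ℝ} {z : ℝ} (hA : ∀ m n, m ≤ n → u m ≤ z → u m ≤ u n)
    (hL : ∃ᶠ n in atTop, u n ≤ z) :
    ∃ P ≤ z, Tendsto u (atTop ⊓ 𝓟 {n | u n ≤ z}) (nhds P) := by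
  let S : Set ℝ := {y | ∃ m, u m ≤ z ∧ y = u m}
  have hne : S.Nonempty := by
    obtain ⟨n, hn⟩ := hL.exists
    exact ⟨_, n, hn, rfl⟩
  have hbd : BddAbove S := ⟨z, by rintro _ ⟨m, hm, rfl⟩; exact hm⟩
  refine ⟨sSup S, csSup_le hne (by rintro _ ⟨m, hm, rfl⟩; exact hm), ?_⟩
  rw [tendsto_order]
  constructor
  · intro l hl
    obtain ⟨_, ⟨m, hm, rfl⟩, hlm⟩ := exists_lt_of_lt_csSup hne hl
    rw [eventually_inf_principal]
    filter_upwards [eventually_ge_atTop m] with n hn _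
    exact hlm.trans_le (hA m n hn hm)
  · intro r hr
    rw [eventually_inf_principal]
    exact Eventually.of_forall fun n hn => (le_csSup hbd ⟨n, hn, rfl⟩).trans_lt hr

theorem tendsto_right_terms {u : ℕ → ℝ} {z : ℝ} (hA : ∀ m n, m ≤ n → z ≤ u m → u n ≤ u m)
    (hL : ∃ᶠ n in atTop, z ≤ u n) :
    ∃ P ≥ z, Tendsto u (atTop ⊓ 𝓟 {n | z ≤ u n}) (nhds P) := by
  obtain ⟨P, hP, ht⟩ := tendsto_left_terms (u := fun n => -u n) (z := -z)
    (fun m n hmn hm => neg_le_neg (hA m n hmn (neg_le_neg_iff.1 hm)))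
    (hL.mono fun n hn => neg_le_neg hn)
  refine ⟨-P, by linarith, ?_⟩
  have := ht.neg
  simpa using this

/-- If both sides of `z` are visited infinitely often, the left terms tend to some `P` and the right
terms to some `Q`. Either `P = Q`, or `F` exchanges them; in the latter case the orbit eventually
alternates between the sides, so its even terms settle on one side. -/
theorem exists_tendsto_even_iterate {F : ℝ → ℝ} {z x : ℝ} (hF : Continuous F)
    (hA : ∀ m n, m ≤ n → F^[m] x ≤ z → F^[m] x ≤ F^[n] x)
    (hB : ∀ m n, m ≤ n → z ≤ F^[m] x → F^[n] x ≤ F^[m] x) :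
    ∃ p, Tendsto (fun n => F^[2 * n] x) atTop (nhds p) := by
  set u : ℕ → ℝ := fun n => F^[n] x with hu
  have hsucc : ∀ n, u (n + 1) = F (u n) := fun n => iterate_succ_apply' F n x
  have hev : ∀ v : ℕ → ℝ, (∀ m n, m ≤ n → v m ≤ z → v m ≤ v n) → (∀ᶠ n in atTop, v n ≤ z) →
      ∃ p, Tendsto v atTop (nhds p) := by
    intro v hv he
    obtain ⟨P, -, hP⟩ := tendsto_left_terms hv he.frequently
    refine ⟨P, hP.mono_left (le_inf le_rfl (le_principal_iff.2 he))⟩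
  have hev' : ∀ v : ℕ → ℝ, (∀ m n, m ≤ n → z ≤ v m → v n ≤ v m) → (∀ᶠ n in atTop, z ≤ v n) →
      ∃ p, Tendsto v atTop (nhds p) := by
    intro v hv he
    obtain ⟨P, -, hP⟩ := tendsto_right_terms hv he.frequently
    refine ⟨P, hP.mono_left (le_inf le_rfl (le_principal_iff.2 he))⟩
  have h2 : Tendsto (fun n : ℕ => 2 * n) atTop atTop :=
    tendsto_atTop_mono (fun n => by simp only [id]; omega) tendsto_id
  by_cases hL : ∃ᶠ n in atTop, u n ≤ z
  swap
  · rw [not_frequently] at hL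
    obtain ⟨p, hp⟩ := hev' u hB (hL.mono fun n hn => (not_le.1 hn).le)
    exact ⟨p, hp.comp h2⟩
  by_cases hR : ∃ᶠ n in atTop, z ≤ u n
  swap
  · rw [not_frequently] at hR
    obtain ⟨p, hp⟩ := hev u hA (hR.mono fun n hn => (not_le.1 hn).le)
    exact ⟨p, hp.comp h2⟩
  obtain ⟨P, hPz, hP⟩ := tendsto_left_terms hA hL
  obtain ⟨Q, hQz, hQ⟩ := tendsto_right_terms hB hR
  rcases eq_or_ne P Q with rfl | hne
  · refine ⟨P, Tendsto.comp (?_ : Tendsto u atTop (nhds P)) h2⟩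
    refine (hP.sup hQ).mono_left ?_
    rw [← inf_sup_left, sup_principal]
    refine le_inf le_rfl (le_principal_iff.2 (Eventually.of_forall fun n => (le_total (u n) z : _ ∨ _)))
  -- Transitions from `S` to `T` at infinitely many times force `F` to send the limit along `S` to
  -- the limit along `T`.
  have hshift : ∀ (S T : Set ℕ) (A B : ℝ), Tendsto u (atTop ⊓ 𝓟 S) (nhds A) →
      Tendsto u (atTop ⊓ 𝓟 T) (nhds B) → (∃ᶠ n in atTop, n ∈ S ∧ n + 1 ∈ T) → F A = B := by
    intro S T A B hS hT hfr
    have : NeBot (atTop ⊓ 𝓟 {n | n ∈ S ∧ n + 1 ∈ T}) := frequently_mem_iff_neBot.1 hfr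
    have h1 : Tendsto (fun n => u (n + 1)) (atTop ⊓ 𝓟 {n | n ∈ S ∧ n + 1 ∈ T}) (nhds (F A)) := by
      simp only [hsucc]
      exact (hF.tendsto A).comp (hS.mono_left (inf_le_inf_left _ (principal_mono.2 fun n hn => hn.1)))
    have h3 : Tendsto (fun n => u (n + 1)) (atTop ⊓ 𝓟 {n | n ∈ S ∧ n + 1 ∈ T}) (nhds B) := by
      refine hT.comp (f := fun n => n + 1) ?_
      refine tendsto_inf.2 ⟨(tendsto_add_atTop_nat 1).mono_left inf_le_left, ?_⟩
      exact tendsto_principal.2 (mem_inf_of_right (mem_principal.2 fun n hn => hn.2))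
    exact tendsto_nhds_unique h1 h3
  have hPQ : P < Q := lt_of_le_of_ne (hPz.trans hQz) hne
  have hLR : ∃ᶠ n in atTop, u n ≤ z ∧ z ≤ u (n + 1) := by
    by_contra hcon
    rw [not_frequently, eventually_atTop] at hcon
    obtain ⟨N, hN⟩ := hcon
    obtain ⟨n, hn, hnz⟩ := frequently_atTop.1 hL N
    have hall : ∀ k, u (n + k + 1) < z := by
      intro k
      induction k with
      | zero =>
        by_contra hh
        exact hN n hn ⟨hnz, not_lt.1 hh⟩
      | succ k ih =>
        by_contra hh
        exact hN (n + k + 1) (by omega) ⟨ih.le, not_lt.1 hh⟩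
    obtain ⟨m, hm, hmz⟩ := frequently_atTop.1 hR (n + 1)
    obtain ⟨k, rfl⟩ := Nat.exists_eq_add_of_le hm
    have := hall k
    rw [show n + k + 1 = n + 1 + k by ring] at this
    linarith
  have hRL : ∃ᶠ n in atTop, z ≤ u n ∧ u (n + 1) ≤ z := by
    by_contra hcon
    rw [not_frequently, eventually_atTop] at hcon
    obtain ⟨N, hN⟩ := hcon
    obtain ⟨n, hn, hnz⟩ := frequently_atTop.1 hR N
    have hall : ∀ k, z < u (n + k + 1) := by
      intro k
      induction k with
      | zero =>
        by_contra hh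
        exact hN n hn ⟨hnz, not_lt.1 hh⟩
      | succ k ih =>
        by_contra hh
        exact hN (n + k + 1) (by omega) ⟨ih.le, not_lt.1 hh⟩
    obtain ⟨m, hm, hmz⟩ := frequently_atTop.1 hL (n + 1)
    obtain ⟨k, rfl⟩ := Nat.exists_eq_add_of_le hm
    have := hall k
    rw [show n + k + 1 = n + 1 + k by ring] at this
    linarith
  have hFP : F P = Q := hshift _ _ _ _ hP hQ hLR
  have hFQ : F Q = P := hshift _ _ _ _ hQ hP hRL
  have hnLL : ∀ᶠ n in atTop, ¬ (u n ≤ z ∧ u (n + 1) ≤ z) := by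
    rw [← not_frequently]
    intro hcon
    exact hne ((hshift _ _ _ _ hP hP hcon).symm.trans hFP)
  have hnRR : ∀ᶠ n in atTop, ¬ (z ≤ u n ∧ z ≤ u (n + 1)) := by
    rw [← not_frequently]
    intro hcon
    exact hne (hFQ.symm.trans (hshift _ _ _ _ hQ hQ hcon))
  obtain ⟨N, hN⟩ := eventually_atTop.1 (hnLL.and hnRR)
  have hstep : ∀ n, N ≤ n → u n ≤ z → u (n + 2) ≤ z := by
    intro n hn hnz
    have h1 : z < u (n + 1) := by
      by_contra hh
      exact (hN n hn).1 ⟨hnz, not_lt.1 hh⟩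
    by_contra hh
    exact (hN (n + 1) (by omega)).2 ⟨h1.le, (not_le.1 hh).le⟩
  by_cases hcase : ∃ n, N ≤ n ∧ u (2 * n) ≤ z
  · obtain ⟨n, hn, hnz⟩ := hcase
    refine hev (fun n => u (2 * n)) (fun i j hij => hA _ _ (by omega)) ?_
    filter_upwards [eventually_ge_atTop n] with m hm
    induction m, hm using Nat.le_induction with
    | base => exact hnz
    | succ m hm ih => exact hstep (2 * m) (by omega) ih
  · push Not at hcase
    refine hev' (fun n => u (2 * n)) (fun i j hij => hB _ _ (by omega)) ?_
    filter_upwards [eventually_ge_atTop N] with m hm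
    exact (hcase m hm).le

/-- The second iterate of a densely chaotic interval map has a horseshoe. -/
theorem DenseLiYorke.realHorseshoe_iterate_two {F : ℝ → ℝ} {a b : ℝ} (hF : Continuous F)
    (hab : a < b) (hb : ∀ x, F x ∈ Icc a b) (h : DenseLiYorke a b F) :
    RealHorseshoe F^[2] := by
  by_contra hns
  have hg := hF.iterate 2
  have hbg : ∀ x, F^[2] x ∈ Icc a b := fun x => hb (F x)
  have h2 := h.iterate_two hF hb
  obtain ⟨z, hz1, hz2⟩ := h.exists_crossing hF hb fun h' => hns h'.iterate_two
  obtain ⟨w, hw1, hw2⟩ := h2.exists_crossing hg hbg hns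
  have hmir : ∀ (G : ℝ → ℝ) (c : ℝ), (∀ x ≤ c, x ≤ G x) → (∀ x, c ≤ x → G x ≤ x) →
      (∀ x ≤ -c, x ≤ _root_.reflect G x) ∧ ∀ x, -c ≤ x → _root_.reflect G x ≤ x := by
    intro G c h1 h2
    exact ⟨fun x hx => le_neg.1 (h2 (-x) (by linarith)), fun x hx => neg_le.1 (h1 (-x) (by linarith))⟩
  obtain ⟨rz1, rz2⟩ := hmir F z hz1 hz2
  obtain ⟨rw1, rw2⟩ := hmir _ w hw1 hw2
  rw [reflect_iterate_eq] at rw1 rw2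
  have hzw : z = w := by
    rcases lt_trichotomy z w with hlt | heq | hgt
    · exact absurd hlt (h.not_crossing_lt hF hb hns hz1 hz2 hw1 hw2)
    · exact heq
    · refine absurd (neg_lt_neg hgt) (h.reflect.not_crossing_lt hF.reflect (reflect_mem_Icc hb)
        (fun h' => hns ?_) rz1 rz2 rw1 rw2)
      rw [← reflect_iterate_eq] at h'
      exact h'.of_reflect
  subst hzw
  -- With `z = w`, all orbits of `F^[2]` converge.
  refine h2.not_forall_tendsto le_rfl hab le_rfl fun x _ => ?_
  have hA : ∀ m n, m ≤ n → F^[m] x ≤ z → F^[m] x ≤ F^[n] x := by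
    intro m n hmn hm
    obtain ⟨k, rfl⟩ := Nat.exists_eq_add_of_le' hmn
    rw [iterate_add_apply]
    exact le_iterate_of_crossing hF hz1 hz2 hw1 hm k
  have hB : ∀ m n, m ≤ n → z ≤ F^[m] x → F^[n] x ≤ F^[m] x := by
    intro m n hmn hm
    obtain ⟨k, rfl⟩ := Nat.exists_eq_add_of_le' hmn
    rw [iterate_add_apply]
    have := le_iterate_of_crossing hF.reflect rz1 rz2 rw1 (neg_le_neg hm) k
    rw [reflect_iterate, neg_neg] at this
    exact neg_le_neg_iff.1 this
  obtain ⟨p, hp⟩ := exists_tendsto_even_iterate hF hA hB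
  exact ⟨p, by simpa only [iterate_mul] using hp⟩

/-! ### Covering intervals and period three -/

/-- Here `d` is the first point of `[x, y]` with value `G y`, and `c` the last point before it with
value `G x`. The extremal choice keeps the values in between strictly inside. -/
theorem exists_image_eq_of_le {G : ℝ → ℝ} (hG : Continuous G) {x y : ℝ} (hxy : x ≤ y)
    (h : G x ≤ G y) : ∃ c d, x ≤ c ∧ c ≤ d ∧ d ≤ y ∧ G '' Icc c d = Icc (G x) (G y) ∧
      ∀ p ∈ Ioo c d, G p ∈ Ioo (G x) (G y) := by
  have hK : IsCompact (Icc x y ∩ G ⁻¹' {G y}) :=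
    isCompact_Icc.inter_right (isClosed_singleton.preimage hG)
  obtain ⟨d, ⟨hd1, hd2⟩, hd3⟩ := hK.exists_isLeast ⟨y, right_mem_Icc.2 hxy, rfl⟩
  have hK' : IsCompact (Icc x d ∩ G ⁻¹' {G x}) :=
    isCompact_Icc.inter_right (isClosed_singleton.preimage hG)
  obtain ⟨c, ⟨hc1, hc2⟩, hc3⟩ := hK'.exists_isGreatest ⟨x, left_mem_Icc.2 hd1.1, rfl⟩
  rw [mem_preimage, mem_singleton_iff] at hc2 hd2
  have himg : G '' Icc c d = Icc (G x) (G y) := by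
    refine Subset.antisymm ?_ (Icc_subset_image hG hc1.2 (Or.inl ⟨hc2.le, hd2.ge⟩))
    rintro _ ⟨t, ht, rfl⟩
    constructor
    · by_contra hlt
      obtain ⟨s, hs, hs'⟩ := Icc_subset_image hG ht.2 (Or.inl ⟨le_rfl, le_rfl⟩)
        (show G x ∈ Icc (G t) (G d) from ⟨(not_le.1 hlt).le, hd2.symm ▸ h⟩)
      have := hc3 ⟨⟨hc1.1.trans (ht.1.trans hs.1), hs.2⟩, hs'⟩
      have hts : t = s := le_antisymm hs.1 (this.trans ht.1)
      rw [hts, hs'] at hlt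
      exact hlt le_rfl
    · by_contra hlt
      obtain ⟨s, hs, hs'⟩ := Icc_subset_image hG ht.1 (Or.inl ⟨le_rfl, le_rfl⟩)
        (show G y ∈ Icc (G c) (G t) from ⟨hc2.symm ▸ h, (not_le.1 hlt).le⟩)
      have := hd3 ⟨⟨hc1.1.trans hs.1, hs.2.trans (ht.2.trans hd1.2)⟩, hs'⟩
      have hts : t = s := le_antisymm (ht.2.trans this) hs.2
      rw [hts, hs'] at hlt
      exact hlt le_rfl
  refine ⟨c, d, hc1.1, hc1.2, hd1.2, himg, fun p hp => ?_⟩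
  have hmem : G p ∈ Icc (G x) (G y) := himg ▸ mem_image_of_mem G ⟨hp.1.le, hp.2.le⟩
  refine ⟨lt_of_le_of_ne hmem.1 fun he => ?_, lt_of_le_of_ne hmem.2 fun he => ?_⟩
  · exact absurd (hc3 ⟨⟨hc1.1.trans hp.1.le, hp.2.le⟩, he.symm⟩) (not_le.2 hp.1)
  · exact absurd (hd3 ⟨⟨hc1.1.trans hp.1.le, hp.2.le.trans hd1.2⟩, he⟩) (not_le.2 hp.2)

/-- If `G` covers `[s, t]` from `[c, d]`, then it maps some subinterval exactly onto `[s, t]`,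
its interior into the interior. -/
theorem exists_image_eq_mapsTo {G : ℝ → ℝ} (hG : Continuous G) {c d s t : ℝ} (hst : s ≤ t)
    (h : Icc s t ⊆ G '' Icc c d) :
    ∃ c' d', c ≤ c' ∧ c' ≤ d' ∧ d' ≤ d ∧ G '' Icc c' d' = Icc s t ∧
      ∀ p ∈ Ioo c' d', G p ∈ Ioo s t := by
  obtain ⟨x, hx, rfl⟩ := h (left_mem_Icc.2 hst)
  obtain ⟨y, hy, rfl⟩ := h (right_mem_Icc.2 hst)
  rcases le_total x y with hxy | hxy
  · obtain ⟨c', d', h1, h2, h3, h4⟩ := exists_image_eq_of_le hG hxy hst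
    exact ⟨c', d', hx.1.trans h1, h2, h3.trans hy.2, h4⟩
  · obtain ⟨c', d', h1, h2, h3, h4, h5⟩ := exists_image_eq_of_le (G := fun t => G (-t))
      (by fun_prop) (neg_le_neg hxy) (by simpa using hst)
    refine ⟨-d', -c', by linarith [hy.1], by linarith, by linarith [hx.2], ?_, fun p hp => ?_⟩
    · simp only [neg_neg] at h4
      rw [← h4, ← image_neg_Icc, image_image]
    · simpa only [neg_neg] using h5 (-p) ⟨by linarith [hp.2], by linarith [hp.1]⟩

theorem exists_image_eq {G : ℝ → ℝ} (hG : Continuous G) {c d s t : ℝ} (hst : s ≤ t)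
    (h : Icc s t ⊆ G '' Icc c d) :
    ∃ c' d', c ≤ c' ∧ c' ≤ d' ∧ d' ≤ d ∧ G '' Icc c' d' = Icc s t := by
  obtain ⟨c', d', h1, h2, h3, h4, -⟩ := exists_image_eq_mapsTo hG hst h
  exact ⟨c', d', h1, h2, h3, h4⟩

theorem exists_fixed_of_subset_image {G : ℝ → ℝ} (hG : Continuous G) {c d : ℝ} (hcd : c ≤ d)
    (h : Icc c d ⊆ G '' Icc c d) : ∃ x ∈ Icc c d, G x = x := by
  obtain ⟨x, hx, hx'⟩ := h (left_mem_Icc.2 hcd)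
  obtain ⟨y, hy, hy'⟩ := h (right_mem_Icc.2 hcd)
  have hsub : uIcc x y ⊆ Icc c d := uIcc_subset_Icc hx hy
  have hcont : ContinuousOn (fun t => G t - t) (uIcc x y) := (hG.sub continuous_id).continuousOn
  obtain ⟨t, ht, ht'⟩ := intermediate_value_uIcc hcont
    (mem_uIcc.2 (Or.inl ⟨by linarith [hx.1], by linarith [hy.2]⟩) : (0 : ℝ) ∈ _)
  exact ⟨t, hsub ht, by simp only at ht'; linarith⟩

/-- A fixed point of `G^[3]` is taken along the loop from the left interval to the right one, to the
right one again, and back. If `G` fixed it, it would lie in both intervals and be their common end,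
which `hfix` excludes. -/
theorem exists_period_three_of_cover {G : ℝ → ℝ} (hG : Continuous G) {c d c' d' : ℝ}
    (hcd : c ≤ d) (hdc : d ≤ c') (hfix : d = c' → G d ≠ d)
    (h : Icc c d ∪ Icc c' d' ⊆ G '' Icc c d ∩ G '' Icc c' d') :
    ∃ x, minimalPeriod G x = 3 := by
  have hJK : Icc c' d' ⊆ G '' Icc c d := fun x hx => (h (Or.inr hx)).1
  have hKK : Icc c' d' ⊆ G '' Icc c' d' := fun x hx => (h (Or.inr hx)).2
  have hKJ : Icc c d ⊆ G '' Icc c' d' := fun x hx => (h (Or.inl hx)).2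
  obtain ⟨p, q, p1, p2, p3, p4⟩ := exists_image_eq hG hcd hKJ
  obtain ⟨r, s, r1, r2, r3, r4⟩ := exists_image_eq hG p2 ((Icc_subset_Icc p1 p3).trans hKK)
  obtain ⟨t, w, t1, t2, t3, t4⟩ := exists_image_eq hG r2 ((Icc_subset_Icc r1 r3).trans hJK)
  have h3 : G^[3] '' Icc t w = Icc c d := by
    rw [← p4, ← r4, ← t4, image_image, image_image]; rfl
  obtain ⟨x, hx, hx3⟩ := exists_fixed_of_subset_image (hG.iterate 3) t2
    (h3.symm ▸ Icc_subset_Icc t1 t3)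
  refine ⟨x, ?_⟩
  have : Fact (Nat.Prime 3) := ⟨Nat.prime_three⟩
  refine minimalPeriod_eq_prime hx3 fun hfx => ?_
  have hGx : G x ∈ Icc r s := t4 ▸ mem_image_of_mem G hx
  rw [hfx.eq] at hGx
  have h1 : x = d := le_antisymm (hx.2.trans t3) (hdc.trans (r1.trans hGx.1))
  have h2 : d = c' := le_antisymm hdc ((r1.trans hGx.1).trans (hx.2.trans t3))
  rw [h1] at hfx
  exact hfix h2 hfx

theorem RealHorseshoe.exists_period_three {G : ℝ → ℝ} (hG : Continuous G)
    (h : RealHorseshoe G) : ∃ x, minimalPeriod G x = 3 := by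
  obtain ⟨c, d, c', d', h1, h2, h3, h4⟩ := h
  by_cases hfix : d = c' → G d ≠ d
  · exact exists_period_three_of_cover hG h1.le h2 hfix h4
  push Not at hfix
  obtain ⟨rfl, hd⟩ := hfix
  -- When the common end `d` is fixed, the left interval is shrunk to the hull of preimages of `c`
  -- and `d'`. Neither preimage is `d`, so the new interval ends strictly before `d`.
  obtain ⟨e, he, hec⟩ := (h4 (Or.inl (left_mem_Icc.2 h1.le))).1
  obtain ⟨e', he', hed⟩ := (h4 (Or.inr (right_mem_Icc.2 h3.le))).1
  have hel : e < d := lt_of_le_of_ne he.2 (by rintro rfl; linarith)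
  have hel' : e' < d := lt_of_le_of_ne he'.2 (by rintro rfl; linarith)
  have hcov : Icc c d' ⊆ G '' Icc (min e e') (max e e') := by
    have := intermediate_value_uIcc (hG.continuousOn (s := uIcc e e'))
    rw [hec, hed, uIcc_of_le (h1.le.trans h3.le)] at this
    exact this
  have hlo : c ≤ min e e' := le_min he.1 he'.1
  have hhi : max e e' < d := max_lt hel hel'
  refine exists_period_three_of_cover hG (d' := d') (min_le_max) hhi.le (fun h => absurd h hhi.ne) ?_
  rintro x (hx | hx)
  · have hx' : x ∈ Icc c d := ⟨hlo.trans hx.1, hx.2.trans hhi.le⟩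
    exact ⟨hcov ⟨hx'.1, hx'.2.trans h3.le⟩, (h4 (Or.inl hx')).2⟩
  · exact ⟨hcov ⟨h1.le.trans hx.1, hx.2⟩, (h4 (Or.inr hx)).2⟩

/-! ### Itineraries that leave an interval and return -/

/-- Some subinterval of `[u, v]` is mapped by `F^[n]` onto `[s, t]`, and its iterates up to time `n`
do not meet `(u, v)`. -/
def Reaches (F : ℝ → ℝ) (u v : ℝ) (n : ℕ) (s t : ℝ) : Prop :=
  ∃ c d, u ≤ c ∧ c ≤ d ∧ d ≤ v ∧ F^[n] '' Icc c d = Icc s t ∧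
    ∀ x ∈ Icc c d, ∀ i, 1 ≤ i → i ≤ n → F^[i] x ∉ Ioo u v

theorem Reaches.one {F : ℝ → ℝ} (hF : Continuous F) {u v s t : ℝ} (hst : s ≤ t)
    (h : Icc s t ⊆ F '' Icc u v) (hd : ∀ x ∈ Icc s t, x ∉ Ioo u v) : Reaches F u v 1 s t := by
  obtain ⟨c, d, h1, h2, h3, h4⟩ := exists_image_eq hF hst h
  refine ⟨c, d, h1, h2, h3, by simpa using h4, fun x hx i hi hi' => ?_⟩
  obtain rfl : i = 1 := le_antisymm hi' hi
  exact hd _ (h4 ▸ mem_image_of_mem F hx)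

theorem Reaches.succ {F : ℝ → ℝ} (hF : Continuous F) {u v s t s' t' : ℝ} {n : ℕ}
    (h : Reaches F u v n s t) (hst : s' ≤ t') (hcov : Icc s' t' ⊆ F '' Icc s t)
    (hd : ∀ x ∈ Icc s' t', x ∉ Ioo u v) : Reaches F u v (n + 1) s' t' := by
  obtain ⟨c, d, h1, h2, h3, h4, h5⟩ := h
  have hcov' : Icc s' t' ⊆ F^[n + 1] '' Icc c d := by
    rw [iterate_succ', image_comp, h4]; exact hcov
  obtain ⟨c', d', i1, i2, i3, i4⟩ := exists_image_eq (hF.iterate (n + 1)) hst hcov'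
  refine ⟨c', d', h1.trans i1, i2, i3.trans h3, i4, fun x hx i hi hi' => ?_⟩
  rcases hi'.eq_or_lt with rfl | hlt
  · exact hd _ (i4 ▸ mem_image_of_mem _ hx)
  · exact h5 x ⟨i1.trans hx.1, hx.2.trans i3⟩ i hi (by omega)

/-- A path from `[u, v]` back to itself, preceded by loops at `[u, v]`, carries a periodic point. -/
theorem Reaches.exists_periodic {F : ℝ → ℝ} (hF : Continuous F) {u v s t : ℝ} {k : ℕ}
    (huv : u ≤ v) (h : Reaches F u v k s t) (hcov : Icc u v ⊆ F '' Icc s t)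
    (hself : Icc u v ⊆ F '' Icc u v) (n : ℕ) :
    ∃ x, F^[n + k + 1] x = x ∧ (∀ i ≤ n, F^[i] x ∈ Icc u v) ∧
      ∀ i, 1 ≤ i → i ≤ k → F^[n + i] x ∉ Ioo u v := by
  obtain ⟨c, d, h1, h2, h3, h4, h5⟩ := h
  have key : ∃ c d, u ≤ c ∧ c ≤ d ∧ d ≤ v ∧ F^[n + k + 1] '' Icc c d = Icc u v ∧
      ∀ x ∈ Icc c d, (∀ i ≤ n, F^[i] x ∈ Icc u v) ∧
        ∀ i, 1 ≤ i → i ≤ k → F^[n + i] x ∉ Ioo u v := by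
    induction n with
    | zero =>
      have hcov' : Icc u v ⊆ F^[k + 1] '' Icc c d := by
        rw [iterate_succ', image_comp, h4]; exact hcov
      obtain ⟨c', d', i1, i2, i3, i4⟩ := exists_image_eq (hF.iterate (k + 1)) huv hcov'
      refine ⟨c', d', h1.trans i1, i2, i3.trans h3, by simpa using i4, fun x hx => ⟨?_, ?_⟩⟩
      · intro i hi
        obtain rfl : i = 0 := by omega
        exact ⟨h1.trans (i1.trans hx.1), (hx.2.trans i3).trans h3⟩
      · intro i hi hi'
        rw [zero_add]
        exact h5 x ⟨i1.trans hx.1, hx.2.trans i3⟩ i hi hi'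
    | succ n ih =>
      obtain ⟨c', d', i1, i2, i3, i4, i5⟩ := ih
      obtain ⟨p, q, p1, p2, p3, p4⟩ :=
        exists_image_eq hF i2 ((Icc_subset_Icc i1 i3).trans hself)
      refine ⟨p, q, p1, p2, p3, ?_, fun x hx => ?_⟩
      · rw [show n + 1 + k + 1 = (n + k + 1) + 1 by ring, iterate_succ, image_comp, p4, i4]
      · have hFx : F x ∈ Icc c' d' := p4 ▸ mem_image_of_mem F hx
        obtain ⟨j1, j2⟩ := i5 _ hFx
        constructor
        · intro i hi
          cases i with
          | zero => exact ⟨p1.trans hx.1, hx.2.trans p3⟩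
          | succ i => exact j1 i (by omega)
        · intro i hi hi'
          rw [show n + 1 + i = (n + i) + 1 by ring]
          exact j2 i hi hi'
  obtain ⟨c', d', i1, i2, i3, i4, i5⟩ := key
  obtain ⟨x, hx, hxx⟩ := exists_fixed_of_subset_image (hF.iterate (n + k + 1)) i2
    (i4.symm ▸ Icc_subset_Icc i1 i3)
  exact ⟨x, hxx, i5 x hx⟩

/-- A cyclic itinerary with a single stay in `A` has the full length as its least period. -/
theorem minimalPeriod_eq_of_itinerary {α : Type*} {F : α → α} {A : Set α} {x : α} {n k : ℕ}
    (hk : 1 ≤ k) (hx : F^[n + k + 1] x = x) (hin : ∀ i ≤ n, F^[i] x ∈ A)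
    (hout : ∀ i, 1 ≤ i → i ≤ k → F^[n + i] x ∉ A) : minimalPeriod F x = n + k + 1 := by
  have hper : IsPeriodicPt F (n + k + 1) x := hx
  refine le_antisymm (hper.minimalPeriod_le (by omega)) ?_
  by_contra hlt
  rw [not_le] at hlt
  set d := minimalPeriod F x with hd
  have hdpos : 0 < d := hper.minimalPeriod_pos (by omega)
  have hshift : ∀ i, F^[i + d] x = F^[i] x := fun i => by
    rw [iterate_add_apply, iterate_minimalPeriod]
  have h1 : ¬ n + d ≤ n + k := by
    intro h
    refine hout d hdpos (by omega) ?_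
    rw [hshift]
    exact hin n le_rfl
  -- Now `k < d < n + k + 1`. Shifting time `n + 1`, which is outside `A`, forward by `d` and back
  -- by the full length gives a time `j ≤ n`, which is inside `A`.
  obtain ⟨j, hj⟩ := Nat.exists_eq_add_of_le' (show n + k + 1 ≤ n + 1 + d by omega)
  refine hout 1 le_rfl hk ?_
  rw [← hshift, hj, iterate_add_apply, hx]
  exact hin j (by omega)

/-! ### Period two -/

/-- In a map without points of period two, points moving to the right are also moved to the right
by the second iterate. -/
theorem lt_iterate_two_of_lt {F : ℝ → ℝ} {a b : ℝ} (hF : Continuous F)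
    (hb : ∀ x, F x ∈ Icc a b) (hno : ∀ x, F (F x) = x → F x = x) {x : ℝ} (hx : x < F x) :
    x < F (F x) := by
  by_contra hcon
  rw [not_lt] at hcon
  -- Such an `x'` makes `F (F t) - t` change sign on `[x', x]`, where `F` has no fixed point, so a
  -- point of period two appears. It is taken just after the last fixed point before `x`, or below
  -- `a` if there is none.
  obtain ⟨x', hx'x, hU, hx'⟩ : ∃ x' ≤ x, (∀ t ∈ Icc x' x, t < F t) ∧ x' < F (F x') := by
    by_cases h : ∃ t ≤ x, F t ≤ t
    · obtain ⟨t, htx, ht⟩ := h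
      obtain ⟨c, -, hcx, hc, hU⟩ := exists_last_fixed hF htx ht hx
      have hev : ∀ᶠ s in nhds c, F s < x := hF.continuousAt.eventually_lt_const (hc.symm ▸ hcx)
      have hev' : ∀ᶠ s in nhdsWithin c (Ioi c), F s < x ∧ s ∈ Ioo c x :=
        (hev.filter_mono nhdsWithin_le_nhds).and (Ioo_mem_nhdsGT hcx)
      obtain ⟨s, hs1, hs2⟩ := hev'.exists
      have hs3 := hU s ⟨hs2.1, hs2.2.le⟩
      exact ⟨s, hs2.2.le, fun t ht => hU t ⟨hs2.1.trans_le ht.1, ht.2⟩,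
        hs3.trans (hU _ ⟨hs2.1.trans hs3, hs1.le⟩)⟩
    · push Not at h
      exact ⟨min x (a - 1), min_le_left _ _, fun t ht => h t ht.2,
        (min_le_right _ _).trans_lt (lt_of_lt_of_le (by linarith) (hb _).1)⟩
  have hcont : ContinuousOn (fun t => F (F t) - t) (Icc x' x) :=
    ((hF.comp hF).sub continuous_id).continuousOn
  obtain ⟨t, ht, ht'⟩ := intermediate_value_Icc' hx'x hcont
    (show (0 : ℝ) ∈ _ from ⟨by linarith, by linarith⟩)
  have := hno t (by simp only at ht'; linarith)
  linarith [hU t ht]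

theorem lt_iterate_of_lt {F : ℝ → ℝ} {a b : ℝ} (hF : Continuous F)
    (hb : ∀ x, F x ∈ Icc a b) (hno : ∀ x, F (F x) = x → F x = x) {x : ℝ} (hx : x < F x)
    (n : ℕ) (hn : 1 ≤ n) : x < F^[n] x := by
  induction n using Nat.strong_induction_on with
  | _ n ih =>
    obtain ⟨n, rfl⟩ := Nat.exists_eq_add_of_le' hn
    rcases Nat.eq_zero_or_pos n with rfl | hn0
    · exact hx
    by_contra hcon
    rw [not_lt, iterate_succ_apply'] at hcon
    set y := F^[n] x with hy
    have hxy : x < y := ih n (by omega) hn0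
    -- The map `2 * t - F t` has the fixed points of `F` but moves all other points the opposite
    -- way.
    obtain ⟨z, hxz, hzy, hz, hD⟩ := exists_last_fixed (F := fun t => 2 * t - F t) (by fun_prop)
      hxy.le (by linarith) (by linarith)
    have hD' : ∀ t ∈ Ioc z y, F t < t := fun t ht => by linarith [hD t ht]
    have hz' : F z = z := by linarith
    -- If `F` stayed below `y` on `[x, z]`, then, since it moves points of `(z, y]` to the left, the
    -- orbit of `x` could not reach `y` at time `n`.
    obtain ⟨t, ht, hty⟩ : ∃ t ∈ Icc x z, y ≤ F t := by
      by_contra! hall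
      have : ∀ i ≤ n, F^[i] x < y := by
        intro i
        induction i with
        | zero => exact fun _ => hxy
        | succ i ihi =>
          intro hi
          have hlt := ihi (by omega)
          rw [iterate_succ_apply']
          rcases le_or_gt (F^[i] x) z with h | h
          · refine hall _ ⟨?_, h⟩
            rcases Nat.eq_zero_or_pos i with rfl | hi0
            · exact le_rfl
            · exact (ih i (by omega) hi0).le
          · exact (hD' _ ⟨h, hlt.le⟩).trans hlt
      exact lt_irrefl _ (this n le_rfl)
    obtain ⟨t', ht', hFt'⟩ := Icc_subset_image hF ht.2 (Or.inr ⟨hz'.le, le_rfl⟩) ⟨hzy.le, hty⟩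
    have := lt_iterate_two_of_lt hF hb hno (x := t') (by rw [hFt']; linarith [ht'.2])
    rw [hFt'] at this
    linarith [ht'.1, ht.1]

/-- The least point of the cycle moves to the right; without period two it could never return to
itself, by `lt_iterate_of_lt`. -/
theorem exists_period_two {F : ℝ → ℝ} {a b : ℝ} (hF : Continuous F)
    (hb : ∀ x, F x ∈ Icc a b) {x : ℝ} (hx : 1 < minimalPeriod F x) :
    ∃ y, minimalPeriod F y = 2 := by
  by_contra! hcon
  have hno : ∀ x, F (F x) = x → F x = x := by
    intro x hx
    by_contra hne
    exact hcon x (minimalPeriod_eq_prime (p := 2) hx hne)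
  set m := minimalPeriod F x with hm
  obtain ⟨i, -, hi⟩ := (Finset.range m).exists_min_image (fun i => F^[i] x)
    ⟨0, Finset.mem_range.2 (by omega)⟩
  have hmin : ∀ j, F^[i] x ≤ F^[j] x := by
    intro j
    rw [← iterate_mod_minimalPeriod_eq (n := j)]
    exact hi _ (Finset.mem_range.2 (Nat.mod_lt _ (by omega)))
  have hxp : x ∈ periodicPts F := minimalPeriod_pos_iff_mem_periodicPts.1 (by omega)
  have hmi : minimalPeriod F (F^[i] x) = m := minimalPeriod_apply_iterate hxp i
  have hlt : F^[i] x < F (F^[i] x) := by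
    refine lt_of_le_of_ne ?_ fun h => ?_
    · simpa only [iterate_succ_apply'] using hmin (i + 1)
    · have : minimalPeriod F (F^[i] x) = 1 := minimalPeriod_eq_one_iff_isFixedPt.2 h.symm
      omega
  have := lt_iterate_of_lt hF hb hno hlt m (by omega)
  rw [← hmi, iterate_minimalPeriod] at this
  exact lt_irrefl _ this

/-! ### Cycles of odd length -/

/-- The finite set `O` is a periodic orbit of `F` of least period `m`. -/
structure IsCycle (F : ℝ → ℝ) (O : Finset ℝ) (m : ℕ) : Prop where
  card : O.card = m
  mapsTo : ∀ y ∈ O, F y ∈ O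
  eq_of_invariant : ∀ T ⊆ O, T.Nonempty → (∀ y ∈ T, F y ∈ T) → T = O
  period : ∀ y ∈ O, minimalPeriod F y = m

theorem exists_isCycle {F : ℝ → ℝ} {x : ℝ} {m : ℕ} (hm : 0 < m) (hx : minimalPeriod F x = m) :
    ∃ O, IsCycle F O m := by
  classical
  have hmem : ∀ j, F^[j] x ∈ (Finset.range m).image (fun i => F^[i] x) := fun j => by
    rw [← iterate_mod_minimalPeriod_eq (n := j), hx]
    exact Finset.mem_image_of_mem _ (Finset.mem_range.2 (Nat.mod_lt _ hm))
  have hxp : x ∈ periodicPts F := minimalPeriod_pos_iff_mem_periodicPts.1 (by omega)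
  refine ⟨(Finset.range m).image (fun i => F^[i] x), ?_, ?_, ?_, ?_⟩
  · rw [Finset.card_image_of_injOn, Finset.card_range]
    intro i hi j hj hij
    rw [Finset.coe_range, mem_Iio] at hi hj
    exact iterate_injOn_Iio_minimalPeriod (hx ▸ hi) (hx ▸ hj) hij
  · intro y hy
    obtain ⟨i, -, rfl⟩ := Finset.mem_image.1 hy
    simpa only [iterate_succ_apply'] using hmem (i + 1)
  · intro T hT hne hinv
    refine Finset.Subset.antisymm hT fun y hy => ?_
    obtain ⟨l, -, rfl⟩ := Finset.mem_image.1 hy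
    obtain ⟨t, ht⟩ := hne
    obtain ⟨i, hi, rfl⟩ := Finset.mem_image.1 (hT ht)
    rw [Finset.mem_range] at hi
    have hit : ∀ j, F^[j] (F^[i] x) ∈ T := by
      intro j
      induction j with
      | zero => exact ht
      | succ j ih => rw [iterate_succ_apply']; exact hinv _ ih
    have := hit (l + (m - i))
    rw [← iterate_add_apply, show l + (m - i) + i = l + m by omega, iterate_add_apply, ← hx,
      iterate_minimalPeriod] at this
    exact this
  · intro y hy
    obtain ⟨i, -, rfl⟩ := Finset.mem_image.1 hy
    rw [minimalPeriod_apply_iterate hxp, hx]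

namespace IsCycle

variable {F : ℝ → ℝ} {O : Finset ℝ} {m : ℕ}

theorem injOn (h : IsCycle F O m) (hne : O.Nonempty) : InjOn F O := by
  classical
  have himg : O.image F = O := by
    refine h.eq_of_invariant _ ?_ (hne.image F) ?_
    · intro y hy
      obtain ⟨t, ht, rfl⟩ := Finset.mem_image.1 hy
      exact h.mapsTo t ht
    · intro y hy
      obtain ⟨t, ht, rfl⟩ := Finset.mem_image.1 hy
      exact Finset.mem_image_of_mem _ (h.mapsTo t ht)
  exact Finset.card_image_iff.1 (by rw [himg])

theorem ne (h : IsCycle F O m) (hm : 2 ≤ m) {y : ℝ} (hy : y ∈ O) : F y ≠ y := by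
  intro hf
  have h1 := h.period y hy
  rw [minimalPeriod_eq_one_iff_isFixedPt.2 hf] at h1
  omega

/-- A cycle of length at least two has two neighbours that are moved towards each other. -/
theorem exists_turning_pair (h : IsCycle F O m) (hm : 2 ≤ m) :
    ∃ u ∈ O, ∃ v ∈ O, u < v ∧ v ≤ F u ∧ F v ≤ u ∧ ∀ y ∈ O, y ≤ u ∨ v ≤ y := by
  classical
  have hne : O.Nonempty := Finset.card_pos.1 (by rw [h.card]; omega)
  have hneU : (O.filter fun y => y < F y).Nonempty := by
    refine ⟨O.min' hne, Finset.mem_filter.2 ⟨O.min'_mem hne, ?_⟩⟩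
    exact lt_of_le_of_ne (O.min'_le _ (h.mapsTo _ (O.min'_mem hne)))
      (h.ne hm (O.min'_mem hne)).symm
  set u := (O.filter fun y => y < F y).max' hneU with hu
  obtain ⟨huO, huF⟩ := Finset.mem_filter.1 (Finset.max'_mem _ hneU)
  rw [← hu] at huO huF
  have hneV : (O.filter fun y => u < y).Nonempty :=
    ⟨F u, Finset.mem_filter.2 ⟨h.mapsTo u huO, huF⟩⟩
  set v := (O.filter fun y => u < y).min' hneV with hv
  obtain ⟨hvO, huv⟩ := Finset.mem_filter.1 (Finset.min'_mem _ hneV)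
  rw [← hv] at hvO huv
  have hnext : ∀ y ∈ O, u < y → v ≤ y := fun y hy hlt =>
    Finset.min'_le _ _ (Finset.mem_filter.2 ⟨hy, hlt⟩)
  have hFv : F v < v := by
    refine lt_of_le_of_ne (not_lt.1 fun hlt => ?_) (h.ne hm hvO)
    exact absurd (Finset.le_max' _ v (Finset.mem_filter.2 ⟨hvO, hlt⟩)) (not_le.2 huv)
  refine ⟨u, huO, v, hvO, huv, hnext _ (h.mapsTo u huO) huF, ?_, fun y hy => ?_⟩
  · by_contra hlt
    exact absurd (hnext _ (h.mapsTo v hvO) (not_le.1 hlt)) (not_le.2 hFv)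
  · rcases le_or_gt y u with hyu | hyu
    · exact Or.inl hyu
    · exact Or.inr (hnext y hy hyu)

/-- `F` is injective on the cycle and exchanges its two sides, so these have equally many points. -/
theorem even_of_swap (h : IsCycle F O m) (hne : O.Nonempty) {u v : ℝ} (huv : u < v)
    (hsw : ∀ y ∈ O, (y ≤ u ∧ v ≤ F y) ∨ (v ≤ y ∧ F y ≤ u)) : Even m := by
  classical
  have hinj := h.injOn hne
  have h1 : (O.filter (· ≤ u)).card ≤ (O.filter fun y => ¬ y ≤ u).card := by
    refine Finset.card_le_card_of_injOn F (fun y hy => ?_)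
      (hinj.mono fun y hy => (Finset.mem_filter.1 hy).1)
    obtain ⟨hyO, hyu⟩ := Finset.mem_filter.1 hy
    refine Finset.mem_filter.2 ⟨h.mapsTo y hyO, ?_⟩
    rcases hsw y hyO with h' | h'
    · linarith [h'.2]
    · linarith [h'.1]
  have h2 : (O.filter fun y => ¬ y ≤ u).card ≤ (O.filter (· ≤ u)).card := by
    refine Finset.card_le_card_of_injOn F (fun y hy => ?_)
      (hinj.mono fun y hy => (Finset.mem_filter.1 hy).1)
    obtain ⟨hyO, hyu⟩ := Finset.mem_filter.1 hy
    refine Finset.mem_filter.2 ⟨h.mapsTo y hyO, ?_⟩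
    rcases hsw y hyO with h' | h'
    · exact absurd h'.1 hyu
    · exact h'.2
  have h3 := Finset.card_filter_add_card_filter_not (s := O) (· ≤ u)
  rw [h.card] at h3
  exact ⟨_, by rw [← h3, le_antisymm h1 h2]⟩

/-- In a cycle of odd length, the central interval `[u, v]` has a path to an interval with no
interior point in common with it that covers it. -/
theorem exists_reaches (h : IsCycle F O m) (hF : Continuous F) (hodd : Odd m)
    {u v : ℝ} (hu : u ∈ O) (hv : v ∈ O) (huv : u < v) (hFu : v ≤ F u) (hFv : F v ≤ u)
    (hnext : ∀ y ∈ O, y ≤ u ∨ v ≤ y) :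
    ∃ k s t, 1 ≤ k ∧ k + 2 ≤ m ∧ Reaches F u v k s t ∧ Icc u v ⊆ F '' Icc s t := by
  classical
  have hne : O.Nonempty := ⟨u, hu⟩
  by_contra hnot
  -- The hull `[l, r]` grows from `[u, v]` by taking extreme images of its cycle points, all of
  -- which change sides. A new point that did not would give the excluded path. If no point were
  -- added, the whole cycle would lie in `[l, r]` and change sides, making `m` even.
  have key : ∀ j, ∃ l ∈ O, ∃ r ∈ O, l ≤ u ∧ v ≤ r ∧
      (∀ y ∈ O, l ≤ y → y ≤ r → (y ≤ u ∧ v ≤ F y) ∨ (v ≤ y ∧ F y ≤ u)) ∧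
      j + 2 ≤ (O.filter fun y => l ≤ y ∧ y ≤ r).card ∧
      (∀ y ∈ O, l ≤ y → y ≤ u → r < F y → Reaches F u v (j + 1) r (F y)) ∧
      (∀ y ∈ O, v ≤ y → y ≤ r → F y < l → Reaches F u v (j + 1) (F y) l) ∧
      (∃ y ∈ O, l ≤ y ∧ y ≤ u ∧ r ≤ F y) ∧ (∃ y ∈ O, v ≤ y ∧ y ≤ r ∧ F y ≤ l) := by
    intro j
    induction j with
    | zero =>
      refine ⟨u, hu, v, hv, le_rfl, le_rfl, ?_, ?_, ?_, ?_, ⟨u, hu, le_rfl, le_rfl, hFu⟩,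
        ⟨v, hv, le_rfl, le_rfl, hFv⟩⟩
      · intro y hy hy1 hy2
        rcases hnext y hy with h' | h'
        · obtain rfl := le_antisymm h' hy1
          exact Or.inl ⟨le_rfl, hFu⟩
        · obtain rfl := le_antisymm h' hy2
          exact Or.inr ⟨le_rfl, hFv⟩
      · rw [zero_add, ← Finset.card_pair huv.ne]
        refine Finset.card_le_card fun y hy => ?_
        rw [Finset.mem_insert, Finset.mem_singleton] at hy
        rcases hy with rfl | rfl
        · exact Finset.mem_filter.2 ⟨hu, le_rfl, huv.le⟩
        · exact Finset.mem_filter.2 ⟨hv, huv.le, le_rfl⟩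
      · intro y _ hy1 hy2 hlt
        obtain rfl := le_antisymm hy1 hy2
        refine Reaches.one hF hlt.le (Icc_subset_image hF huv.le (Or.inr ⟨by linarith, le_rfl⟩)) ?_
        exact fun x hx hx' => absurd hx.1 (not_le.2 hx'.2)
      · intro y _ hy1 hy2 hlt
        obtain rfl := le_antisymm hy1 hy2
        refine Reaches.one hF hlt.le (Icc_subset_image hF huv.le (Or.inr ⟨le_rfl, by linarith⟩)) ?_
        exact fun x hx hx' => absurd hx.2 (not_le.2 hx'.1)
    | succ j ih =>
      obtain ⟨l, hl, r, hr, hlu, hvr, hsw, hcard, hNr, hNl, ⟨er, her, er1, er2, er3⟩,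
        ⟨el, hel, el1, el2, el3⟩⟩ := ih
      obtain ⟨yR, hyR, hRmax⟩ := (O.filter fun y => l ≤ y ∧ y ≤ u).exists_max_image F
        ⟨u, Finset.mem_filter.2 ⟨hu, hlu, le_rfl⟩⟩
      obtain ⟨yL, hyL, hLmin⟩ := (O.filter fun y => v ≤ y ∧ y ≤ r).exists_min_image F
        ⟨v, Finset.mem_filter.2 ⟨hv, le_rfl, hvr⟩⟩
      obtain ⟨hyRO, yR1, yR2⟩ := Finset.mem_filter.1 hyR
      obtain ⟨hyLO, yL1, yL2⟩ := Finset.mem_filter.1 hyL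
      have hRmax' : ∀ y ∈ O, l ≤ y → y ≤ u → F y ≤ F yR := fun y hy h1 h2 =>
        hRmax y (Finset.mem_filter.2 ⟨hy, h1, h2⟩)
      have hLmin' : ∀ y ∈ O, v ≤ y → y ≤ r → F yL ≤ F y := fun y hy h1 h2 =>
        hLmin y (Finset.mem_filter.2 ⟨hy, h1, h2⟩)
      have hrR : r ≤ F yR := er3.trans (hRmax' er her er1 er2)
      have hLl : F yL ≤ l := (hLmin' el hel el1 el2).trans el3
      have hFl : v ≤ F l := by
        rcases hsw l hl le_rfl (by linarith) with h' | h'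
        · exact h'.2
        · linarith [h'.1]
      have hFr : F r ≤ u := by
        rcases hsw r hr (by linarith) le_rfl with h' | h'
        · linarith [h'.1]
        · exact h'.2
      have hcardlt : ∀ y ∈ O, ¬ (l ≤ y ∧ y ≤ r) → j + 3 ≤ m := by
        intro y hy hy'
        have : (O.filter fun y => l ≤ y ∧ y ≤ r).card < O.card := by
          refine Finset.card_lt_card (Finset.filter_ssubset.2 ⟨y, hy, hy'⟩)
        rw [h.card] at this
        omega
      refine ⟨F yL, h.mapsTo _ hyLO, F yR, h.mapsTo _ hyRO, hLl.trans hlu, hvr.trans hrR, ?_, ?_, ?_,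
        ?_, ⟨yR, hyRO, hLl.trans yR1, yR2, le_rfl⟩, ⟨yL, hyLO, yL1, yL2.trans hrR, le_rfl⟩⟩
      · intro y hy hy1 hy2
        by_contra hun
        rw [not_or] at hun
        rcases hnext y hy with hyu | hvy
        · have hyl : y < l := by
            by_contra hh
            rcases hsw y hy (not_lt.1 hh) (by linarith) with h' | h'
            · exact hun.1 h'
            · exact hun.2 h'
          have hFy : F y ≤ u := by
            rcases hnext _ (h.mapsTo y hy) with h' | h'
            · exact h'
            · exact absurd ⟨hyu, h'⟩ hun.1
          -- `y` stays on the left while `l` goes to the right, so `[y, l]`, part of the interval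
          -- just reached, covers `[u, v]`.
          refine hnot ⟨j + 1, F yL, l, by omega, hcardlt y hy (fun h' => by linarith [h'.1]),
            hNl yL hyLO yL1 yL2 (hy1.trans_lt hyl), ?_⟩
          refine (Icc_subset_image hF hyl.le (Or.inl ⟨hFy, hFl⟩)).trans
            (image_mono (Icc_subset_Icc hy1 le_rfl))
        · have hyl : r < y := by
            by_contra hh
            rcases hsw y hy (by linarith) (not_lt.1 hh) with h' | h'
            · exact hun.1 h'
            · exact hun.2 h'
          have hFy : v ≤ F y := by
            rcases hnext _ (h.mapsTo y hy) with h' | h'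
            · exact absurd ⟨hvy, h'⟩ hun.2
            · exact h'
          refine hnot ⟨j + 1, r, F yR, by omega, hcardlt y hy (fun h' => by linarith [h'.2]),
            hNr yR hyRO yR1 yR2 (hyl.trans_le hy2), ?_⟩
          refine (Icc_subset_image hF hyl.le (Or.inl ⟨hFr, hFy⟩)).trans
            (image_mono (Icc_subset_Icc le_rfl hy2))
      · have hsub : (O.filter fun y => l ≤ y ∧ y ≤ r) ⊆
            O.filter fun y => F yL ≤ y ∧ y ≤ F yR := by
          intro y hy
          obtain ⟨hy1, hy2, hy3⟩ := Finset.mem_filter.1 hy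
          exact Finset.mem_filter.2 ⟨hy1, hLl.trans hy2, hy3.trans hrR⟩
        by_contra hlt
        have heq := Finset.eq_of_subset_of_card_le hsub (by omega)
        have hinv : (O.filter fun y => l ≤ y ∧ y ≤ r) = O := by
          refine h.eq_of_invariant _ (Finset.filter_subset _ _)
            ⟨u, Finset.mem_filter.2 ⟨hu, hlu, by linarith⟩⟩ fun y hy => ?_
          rw [heq]
          obtain ⟨hy1, hy2, hy3⟩ := Finset.mem_filter.1 hy
          refine Finset.mem_filter.2 ⟨h.mapsTo y hy1, ?_⟩
          rcases hsw y hy1 hy2 hy3 with h' | h'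
          · exact ⟨by linarith [h'.2], hRmax' y hy1 hy2 h'.1⟩
          · exact ⟨hLmin' y hy1 h'.1 hy3, by linarith [h'.2]⟩
        refine Nat.not_even_iff_odd.2 hodd (h.even_of_swap hne huv fun y hy => ?_)
        obtain ⟨-, hy2, hy3⟩ := Finset.mem_filter.1 (hinv.symm ▸ hy)
        exact hsw y hy hy2 hy3
      · intro y hy hy1 hy2 hlt
        have hyl : y < l := by
          by_contra hh
          exact absurd (hRmax' y hy (not_lt.1 hh) hy2) (not_le.2 hlt)
        refine (hNl yL hyLO yL1 yL2 (hy1.trans_lt hyl)).succ hF hlt.le ?_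
          (fun x hx hx' => by linarith [hx.1, hx'.2])
        exact (Icc_subset_image hF hyl.le (Or.inr ⟨hRmax' l hl le_rfl hlu, le_rfl⟩)).trans
          (image_mono (Icc_subset_Icc hy1 le_rfl))
      · intro y hy hy1 hy2 hlt
        have hyl : r < y := by
          by_contra hh
          exact absurd (hLmin' y hy hy1 (not_lt.1 hh)) (not_le.2 hlt)
        refine (hNr yR hyRO yR1 yR2 (hyl.trans_le hy2)).succ hF hlt.le ?_
          (fun x hx hx' => by linarith [hx.2, hx'.1])
        exact (Icc_subset_image hF hyl.le (Or.inr ⟨le_rfl, hLmin' r hr hvr le_rfl⟩)).trans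
          (image_mono (Icc_subset_Icc le_rfl hy2))
  -- Stage `m` would require `m + 2` points in a cycle of `m` points.
  obtain ⟨l, -, r, -, -, -, -, hcard, -⟩ := key m
  have := Finset.card_le_card (Finset.filter_subset (fun y => l ≤ y ∧ y ≤ r) O)
  rw [h.card] at this
  omega

end IsCycle

/-- A continuous map with a point of odd period `m ≥ 3` has points of all larger periods. -/
theorem exists_period_of_odd {F : ℝ → ℝ} (hF : Continuous F) {x : ℝ} {m : ℕ} (hm : 3 ≤ m)
    (hodd : Odd m) (hx : minimalPeriod F x = m) {q : ℕ} (hq : m < q) :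
    ∃ y, minimalPeriod F y = q := by
  obtain ⟨O, hO⟩ := exists_isCycle (by omega) hx
  obtain ⟨u, hu, v, hv, huv, hFu, hFv, hnext⟩ := hO.exists_turning_pair (by omega)
  obtain ⟨k, s, t, hk1, hk2, hr, hcov⟩ :=
    hO.exists_reaches hF hodd hu hv huv hFu hFv hnext
  obtain ⟨n, rfl⟩ := Nat.exists_eq_add_of_le' (show k + 1 ≤ q by omega)
  obtain ⟨y, hy1, hy2, hy3⟩ := hr.exists_periodic hF huv.le hcov
    (Icc_subset_image hF huv.le (Or.inr ⟨by linarith, hFu⟩)) n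
  have hn : 2 ≤ n := by omega
  -- A cycle point with its first two iterates in `[u, v]` would alternate between `u` and `v`,
  -- against `m ≥ 3`.
  have hyO : y ∉ O := by
    intro hyO
    have hend : ∀ z ∈ O, z ∈ Icc u v → z = u ∨ z = v := by
      intro z hz hzI
      rcases hnext z hz with h' | h'
      · exact Or.inl (le_antisymm h' hzI.1)
      · exact Or.inr (le_antisymm hzI.2 h')
    have hswap : ∀ z ∈ O, z ∈ Icc u v → F z ∈ Icc u v → (z = u ∧ F z = v) ∨ (z = v ∧ F z = u) := by
      intro z hz hz1 hz2
      have := hO.ne (by omega) hz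
      rcases hend z hz hz1 with rfl | rfl <;> rcases hend _ (hO.mapsTo _ hz) hz2 with h' | h'
      · exact absurd h' this
      · exact Or.inl ⟨rfl, h'⟩
      · exact Or.inr ⟨rfl, h'⟩
      · exact absurd h' this
    have h0 : y ∈ Icc u v := hy2 0 (by omega)
    have h1 : F y ∈ Icc u v := hy2 1 (by omega)
    have h2 : F (F y) ∈ Icc u v := hy2 2 hn
    have hper : IsPeriodicPt F 2 y := by
      show F (F y) = y
      rcases hswap y hyO h0 h1 with ⟨e1, e2⟩ | ⟨e1, e2⟩ <;>
        rcases hswap _ (hO.mapsTo y hyO) h1 h2 with ⟨e3, e4⟩ | ⟨e3, e4⟩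
      · rw [e2] at e3; linarith
      · rw [e4, e1]
      · rw [e4, e1]
      · rw [e2] at e3; linarith
    have := hper.minimalPeriod_le (by omega)
    rw [hO.period y hyO] at this
    omega
  refine ⟨y, ?_⟩
  refine minimalPeriod_eq_of_itinerary (A := Icc u v) hk1 hy1 hy2 fun i hi hi' hmem => ?_
  have hout := hy3 i hi hi'
  -- The path only avoids the open interval; an iterate in the closed one would be `u` or `v`, and
  -- the orbit of `y` would then lie in the cycle.
  have hzO : F^[n + i] y ∈ O := by
    rcases hmem.1.eq_or_lt with h1 | h1
    · exact h1 ▸ hu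
    · rcases hmem.2.eq_or_lt with h2 | h2
      · exact h2 ▸ hv
      · exact absurd ⟨h1, h2⟩ hout
  have hit : ∀ j, F^[j] (F^[n + i] y) ∈ O := by
    intro j
    induction j with
    | zero => exact hzO
    | succ j ih => rw [iterate_succ_apply']; exact hO.mapsTo _ ih
  have := hit (n + k + 1 - (n + i))
  rw [← iterate_add_apply, show n + k + 1 - (n + i) + (n + i) = n + k + 1 by omega, hy1] at this
  exact hyO this

/-! ### Sharkovskii's order and the type -/

theorem SharkovskiiLT.of_odd {p m : ℕ} (h : SharkovskiiLT p m) (hp : Odd p) :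
    Even m ∨ m = 1 ∨ p ≤ m := by
  have hpow : ∀ a q : ℕ, Odd (2 ^ a * q) → a = 0 := by
    intro a q h
    by_contra ha
    have : Even (2 ^ a * q) := (Nat.even_pow.2 ⟨even_two, ha⟩).mul_right q
    exact Nat.not_even_iff_odd.2 h this
  cases h with
  | same_exponent a p q _ _ _ hpq =>
    exact Or.inr (Or.inr (Nat.mul_le_mul_left _ hpq.le))
  | lower_exponent a b p q hab =>
    exact Or.inl ((Nat.even_pow.2 ⟨even_two, by omega⟩).mul_right q)
  | power_of_two a b p =>
    rcases Nat.eq_zero_or_pos b with rfl | hb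
    · exact Or.inr (Or.inl (pow_zero 2))
    · exact Or.inl (Nat.even_pow.2 ⟨even_two, by omega⟩)
  | powers_of_two a b hab =>
    have := hpow a 1 (by simpa using hp)
    omega

theorem SharkovskiiLT.of_even {p m : ℕ} (h : SharkovskiiLT p m) (hp : Even p) :
    Even m ∨ m = 1 := by
  cases h with
  | same_exponent a p q hpo =>
    refine Or.inl (Even.mul_right (Nat.even_pow.2 ⟨even_two, ?_⟩) q)
    rintro rfl
    rw [pow_zero, one_mul] at hp
    exact Nat.not_even_iff_odd.2 hpo hp
  | lower_exponent a b p q hab =>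
    exact Or.inl ((Nat.even_pow.2 ⟨even_two, by omega⟩).mul_right q)
  | power_of_two a b p =>
    rcases Nat.eq_zero_or_pos b with rfl | hb
    · exact Or.inr (pow_zero 2)
    · exact Or.inl (Nat.even_pow.2 ⟨even_two, by omega⟩)
  | powers_of_two a b hab =>
    rcases Nat.eq_zero_or_pos b with rfl | hb
    · exact Or.inr (pow_zero 2)
    · exact Or.inl (Nat.even_pow.2 ⟨even_two, by omega⟩)

theorem sharkovskiiLE_odd_iff {p m : ℕ} (hp : Odd p) (hp1 : 1 < p) (hm : 0 < m) :
    SharkovskiiLE p m ↔ Even m ∨ m = 1 ∨ p ≤ m := by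
  refine ⟨?_, fun h => ?_⟩
  · rintro (rfl | h)
    · exact Or.inr (Or.inr le_rfl)
    · exact h.of_odd hp
  · obtain ⟨b, q, hq, rfl⟩ := Nat.exists_eq_two_pow_mul_odd hm.ne'
    rcases Nat.lt_or_ge 1 q with hq2 | hq2
    · rcases Nat.eq_zero_or_pos b with rfl | hb
      · rw [pow_zero, one_mul] at h ⊢
        have hpq : p ≤ q := by
          rcases h with h | h | h
          · exact absurd hq (Nat.not_odd_iff_even.2 h)
          · omega
          · exact h
        rcases hpq.eq_or_lt with h' | h'
        · exact Or.inl h'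
        · right
          simpa using SharkovskiiLT.same_exponent 0 p q hp hq hp1 h'
      · right
        simpa using SharkovskiiLT.lower_exponent 0 b p q hb hp hq hp1 hq2
    · obtain rfl : q = 1 := by have := hq.pos; omega
      right
      simpa using SharkovskiiLT.power_of_two 0 b p hp hp1

theorem sharkovskiiLE_six_iff {m : ℕ} (hm : 0 < m) :
    SharkovskiiLE 6 m ↔ Even m ∨ m = 1 := by
  refine ⟨?_, fun h => ?_⟩
  · rintro (rfl | h)
    · exact Or.inl (by decide)
    · exact h.of_even (by decide)
  · obtain ⟨b, q, hq, rfl⟩ := Nat.exists_eq_two_pow_mul_odd hm.ne'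
    have h3 : Odd 3 := by decide
    rcases Nat.lt_or_ge 1 q with hq2 | hq2
    · rcases Nat.lt_or_ge b 2 with hb | hb
      · have hb1 : b = 1 := by
          by_contra hb1
          obtain rfl : b = 0 := by omega
          rw [pow_zero, one_mul] at h
          rcases h with h | h
          · exact absurd hq (Nat.not_odd_iff_even.2 h)
          · omega
        subst hb1
        obtain ⟨k, rfl⟩ := hq
        rcases Nat.lt_or_ge 1 k with hk | hk
        · right
          simpa using SharkovskiiLT.same_exponent 1 3 (2 * k + 1) h3 ⟨k, rfl⟩ (by omega) (by omega)
        · obtain rfl : k = 1 := by omega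
          exact Or.inl rfl
      · right
        simpa using SharkovskiiLT.lower_exponent 1 b 3 q (by omega) h3 hq (by omega) hq2
    · obtain rfl : q = 1 := by have := hq.pos; omega
      right
      simpa using SharkovskiiLT.power_of_two 1 b 3 h3 (by omega)

theorem RealHorseshoe.exists_period {G : ℝ → ℝ} {a b : ℝ} (hG : Continuous G)
    (hb : ∀ x, G x ∈ Icc a b) (h : RealHorseshoe G) {m : ℕ} (hm : 2 ≤ m) :
    ∃ x, minimalPeriod G x = m := by
  obtain ⟨x, hx⟩ := h.exists_period_three hG
  rcases Nat.lt_or_ge 3 m with h3 | h3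
  · exact exists_period_of_odd hG le_rfl (by decide) hx h3
  · rcases h3.eq_or_lt with rfl | h3
    · exact ⟨x, hx⟩
    · obtain rfl : m = 2 := by omega
      exact exists_period_two hG hb (x := x) (by omega)

/-- If the second iterate has a horseshoe, then all even numbers are periods. -/
theorem exists_even_period {F : ℝ → ℝ} {a b : ℝ} (hF : Continuous F)
    (hb : ∀ x, F x ∈ Icc a b) (h : RealHorseshoe F^[2]) {m : ℕ} (hm : 0 < m) :
    ∃ x, minimalPeriod F x = 2 * m := by
  -- A point of period `k` for `F^[2]` has period `2 * k` for `F`, or period `k` with `k` odd. In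
  -- the odd case, larger even periods come from `exists_period_of_odd`.
  have key : ∀ k, 2 ≤ k → (∃ x, minimalPeriod F x = 2 * k) ∨
      Odd k ∧ ∃ x, minimalPeriod F x = k := by
    intro k hk
    obtain ⟨x, hx⟩ := h.exists_period (hF.iterate 2) (fun x => hb (F x)) hk
    rw [minimalPeriod_iterate_eq_div_gcd two_ne_zero] at hx
    rcases Nat.even_or_odd (minimalPeriod F x) with he | ho
    · rw [Nat.gcd_eq_right he.two_dvd] at hx
      exact Or.inl ⟨x, by have := Nat.div_mul_cancel he.two_dvd; omega⟩
    · rw [Nat.Coprime.gcd_eq_one (Nat.coprime_two_right.2 ho), Nat.div_one] at hx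
      exact Or.inr ⟨hx ▸ ho, x, hx⟩
  rcases Nat.lt_or_ge 1 m with h1 | h1
  · rcases key m h1 with h' | ⟨ho, x, hx⟩
    · exact h'
    · have : m ≠ 2 := by rintro rfl; exact absurd ho (by decide)
      exact exists_period_of_odd hF (by omega) ho hx (by omega)
  · obtain rfl : m = 1 := by omega
    obtain ⟨x, hx⟩ | ⟨-, x, hx⟩ := key 2 le_rfl <;>
      exact exists_period_two hF hb (x := x) (by omega)

theorem isOfSharkovskiiTypeAtMost_six_of_real {F : ℝ → ℝ} {a b : ℝ} (hab : a ≤ b)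
    (hF : Continuous F) (hb : ∀ x, F x ∈ Icc a b) (h : RealHorseshoe F^[2]) :
    IsOfSharkovskiiTypeAtMost F 6 := by
  classical
  have hone : ∃ x, minimalPeriod F x = 1 := by
    obtain ⟨x, -, hx⟩ := exists_mem_Icc_isFixedPt hF.continuousOn hab (hb a).1 (hb b).2
    exact ⟨x, minimalPeriod_eq_one_iff_isFixedPt.2 hx⟩
  have heven : ∀ m, 0 < m → Even m → ∃ x, minimalPeriod F x = m := by
    rintro m hm ⟨k, rfl⟩
    rw [← two_mul]
    exact exists_even_period hF hb h (by omega)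
  by_cases hodd : ∃ p, (Odd p ∧ 1 < p) ∧ ∃ x, minimalPeriod F x = p
  · obtain ⟨⟨hp, hp1⟩, x, hx⟩ := Nat.find_spec hodd
    have hmin : ∀ m, Odd m → 1 < m → (∃ x, minimalPeriod F x = m) → Nat.find hodd ≤ m :=
      fun m h1 h2 h3 => Nat.find_min' hodd ⟨⟨h1, h2⟩, h3⟩
    generalize Nat.find hodd = p at hp hp1 hx hmin
    refine ⟨p, (sharkovskiiLE_odd_iff hp hp1 (by omega)).2 (Or.inl (by decide)), by omega, ?_⟩
    ext m
    refine ⟨fun ⟨hm, hper⟩ => ⟨hm, (sharkovskiiLE_odd_iff hp hp1 hm).2 ?_⟩, fun ⟨hm, hle⟩ => ⟨hm, ?_⟩⟩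
    · rcases Nat.even_or_odd m with he | ho
      · exact Or.inl he
      · rcases Nat.lt_or_ge 1 m with h1 | h1
        · exact Or.inr (Or.inr (hmin m ho h1 hper))
        · exact Or.inr (Or.inl (by omega))
    · rcases (sharkovskiiLE_odd_iff hp hp1 hm).1 hle with he | rfl | hpm
      · exact heven m hm he
      · exact hone
      · rcases hpm.eq_or_lt with rfl | hlt
        · exact ⟨x, hx⟩
        · have : p ≠ 2 := by rintro rfl; exact absurd hp (by decide)
          exact exists_period_of_odd hF (by omega) hp hx hlt
  · refine ⟨6, Or.inl rfl, by omega, ?_⟩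
    ext m
    refine ⟨fun ⟨hm, hper⟩ => ⟨hm, (sharkovskiiLE_six_iff hm).2 ?_⟩, fun ⟨hm, hle⟩ => ⟨hm, ?_⟩⟩
    · by_contra hcon
      rw [not_or, Nat.not_even_iff_odd] at hcon
      exact hodd ⟨m, ⟨hcon.1, by omega⟩, hper⟩
    · rcases (sharkovskiiLE_six_iff hm).1 hle with he | rfl
      · exact heven m hm he
      · exact hone

/-! ### Entropy -/

/-- Level `n` of the tree of intervals of a horseshoe: `2 ^ n` intervals with disjoint interiors,
each of which is mapped onto the hull of the horseshoe by the `n`-th iterate. -/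
theorem RealHorseshoe.exists_intervals {G : ℝ → ℝ} (hG : Continuous G) (h : RealHorseshoe G) :
    ∃ lo hi, lo < hi ∧ Icc lo hi ⊆ range G ∧ ∀ n : ℕ, ∃ s t : (Fin n → Bool) → ℝ,
      (∀ w, lo ≤ s w ∧ s w < t w ∧ t w ≤ hi ∧ G^[n] '' Icc (s w) (t w) = Icc lo hi) ∧
      ∀ w w', w ≠ w' → Disjoint (Ioo (s w) (t w)) (Ioo (s w') (t w')) := by
  obtain ⟨c, d, c', d', h1, h2, h3, h4⟩ := h
  have hcov : ∀ p q, Icc c d ∪ Icc c' d' ⊆ G '' Icc p q → Icc c d' ⊆ G '' Icc p q := by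
    intro p q hpq
    have hconn : (G '' Icc p q).OrdConnected :=
      (isPreconnected_Icc.image G hG.continuousOn).ordConnected
    exact hconn.out (hpq (Or.inl (left_mem_Icc.2 h1.le))) (hpq (Or.inr (right_mem_Icc.2 h3.le)))
  have hJ := hcov c d (h4.trans inter_subset_left)
  have hK := hcov c' d' (h4.trans inter_subset_right)
  refine ⟨c, d', by linarith, hJ.trans (image_subset_range _ _), fun n => ?_⟩
  induction n with
  | zero =>
    refine ⟨fun _ => c, fun _ => d', fun w => ⟨le_rfl, by linarith, le_rfl, by simp⟩, ?_⟩
    exact fun w w' hne => absurd (Subsingleton.elim w w') hne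
  | succ n ih =>
    obtain ⟨s, t, hst, hdisj⟩ := ih
    have hstep : ∀ (e : Bool) (w : Fin n → Bool), ∃ p q, (if e then c' else c) ≤ p ∧ p ≤ q ∧
        q ≤ (if e then d' else d) ∧ G '' Icc p q = Icc (s w) (t w) ∧
        ∀ x ∈ Ioo p q, G x ∈ Ioo (s w) (t w) := by
      intro e w
      refine exists_image_eq_mapsTo hG (hst w).2.1.le ?_
      refine (Icc_subset_Icc (hst w).1 (hst w).2.2.1).trans ?_
      cases e
      · simpa using hJ
      · simpa using hK
    choose p q hp hpq hq himg hint using hstep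
    refine ⟨fun w => p (w 0) (Fin.tail w), fun w => q (w 0) (Fin.tail w), fun w => ⟨?_, ?_, ?_, ?_⟩,
      fun w w' hne => ?_⟩
    · refine le_trans ?_ (hp _ _)
      split_ifs <;> linarith
    · refine lt_of_le_of_ne (hpq _ _) fun he => ?_
      have := himg (w 0) (Fin.tail w)
      rw [show p (w 0) (Fin.tail w) = q (w 0) (Fin.tail w) from he, Icc_self,
        image_singleton] at this
      have h5 := this.symm.subset (left_mem_Icc.2 (hst (Fin.tail w)).2.1.le)
      have h6 := this.symm.subset (right_mem_Icc.2 (hst (Fin.tail w)).2.1.le)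
      rw [mem_singleton_iff] at h5 h6
      linarith [(hst (Fin.tail w)).2.1]
    · refine (hq _ _).trans ?_
      split_ifs <;> linarith
    · rw [iterate_succ, image_comp, himg]
      exact (hst _).2.2.2
    · rw [Set.disjoint_left]
      intro x hx hx'
      by_cases h0 : w 0 = w' 0
      · have htail : Fin.tail w ≠ Fin.tail w' := fun ht => hne (by
          rw [← Fin.cons_self_tail w, ← Fin.cons_self_tail w', h0, ht])
        exact Set.disjoint_left.1 (hdisj _ _ htail) (hint _ _ x hx) (hint _ _ x hx')
      · have e1 := hp (w 0) (Fin.tail w)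
        have e2 := hq (w 0) (Fin.tail w)
        have e3 := hp (w' 0) (Fin.tail w')
        have e4 := hq (w' 0) (Fin.tail w')
        have x1 := hx.1
        have x2 := hx.2
        have x3 := hx'.1
        have x4 := hx'.2
        cases hw : w 0 <;> cases hw' : w' 0 <;> simp only [hw, hw', if_true, if_false,
          Bool.false_eq_true] at h0 e1 e2 e3 e4 x1 x2 x3 x4
        · exact h0 trivial
        · linarith
        · linarith
        · exact h0 trivial

/-- Among `2 * M` intervals with disjoint interiors, `M` are pairwise disjoint. -/
theorem exists_disjoint_Icc {ι : Type*} [Fintype ι] {M : ℕ} (hcard : Fintype.card ι = 2 * M)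
    {s t : ι → ℝ} (hst : ∀ i, s i < t i)
    (hdisj : ∀ i j, i ≠ j → Disjoint (Ioo (s i) (t i)) (Ioo (s j) (t j))) :
    ∃ φ : Fin M → ι, ∀ i j, i ≠ j →
      Disjoint (Icc (s (φ i)) (t (φ i))) (Icc (s (φ j)) (t (φ j))) := by
  classical
  have hle : ∀ i j, i ≠ j → s i ≤ s j → t i ≤ s j := by
    intro i j hij hs
    by_contra hlt
    obtain ⟨x, hx1, hx2⟩ := exists_between (lt_min (not_le.1 hlt) (hst j))
    exact Set.disjoint_left.1 (hdisj i j hij) ⟨hs.trans_lt hx1, hx2.trans_le (min_le_left _ _)⟩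
      ⟨hx1, hx2.trans_le (min_le_right _ _)⟩
  have hinj : Injective s := by
    intro i j hs
    by_contra hij
    linarith [hle i j hij hs.le, hst i]
  have hS : (Finset.univ.image s).card = 2 * M := by
    rw [Finset.card_image_of_injective _ hinj, Finset.card_univ, hcard]
  let e := (Finset.univ.image s).orderEmbOfFin hS
  have hψ : ∀ k, ∃ i, s i = e k := fun k => by
    obtain ⟨i, -, hi⟩ := Finset.mem_image.1 ((Finset.univ.image s).orderEmbOfFin_mem hS k)
    exact ⟨i, hi⟩
  choose ψ hψ using hψ
  have hψlt : ∀ k l, k < l → t (ψ k) ≤ s (ψ l) := by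
    intro k l hkl
    have : s (ψ k) < s (ψ l) := by rw [hψ, hψ]; exact e.strictMono hkl
    exact hle _ _ (fun h => by rw [h] at this; exact lt_irrefl _ this) this.le
  have key : ∀ i j : Fin M, i < j →
      t (ψ ⟨2 * i, by omega⟩) < s (ψ ⟨2 * j, by omega⟩) := by
    intro i j hij
    have hij' : (i : ℕ) < j := hij
    have h1 := hψlt ⟨2 * i, by omega⟩ ⟨2 * i + 1, by omega⟩ (by simp [Fin.lt_def])
    have h2 := hψlt ⟨2 * i + 1, by omega⟩ ⟨2 * j, by omega⟩ (by simp only [Fin.lt_def]; omega)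
    linarith [hst (ψ ⟨2 * i + 1, by omega⟩)]
  -- Every second interval from left to right: the omitted one between them has positive length.
  refine ⟨fun i => ψ ⟨2 * i, by omega⟩, fun i j hij => ?_⟩
  rw [Set.disjoint_left]
  intro x hx hx'
  rcases lt_or_gt_of_ne hij with h | h
  · linarith [key i j h, hx.2, hx'.1]
  · linarith [key j i h, hx.1, hx'.2]

/-- Pairwise disjoint compact sets, each of which covers all of them under `f^[N]`, provide
separated sets of exponential size. -/
theorem pow_le_netMaxcard {X : Type*} [MetricSpace X] {f : X → X} {K N : ℕ} (hN : 0 < N)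
    (hK : 0 < K) {C : Fin K → Set X} (hC : ∀ i, IsCompact (C i)) (hne : ∀ i, (C i).Nonempty)
    (hdisj : ∀ i j, i ≠ j → Disjoint (C i) (C j)) (hcov : ∀ i j, C j ⊆ f^[N] '' C i) :
    ∃ U ∈ uniformity X, ∀ m, ((K ^ m : ℕ) : ℕ∞) ≤ Dynamics.netMaxcard f univ U (N * m) := by
  classical
  obtain ⟨δ, hδ, hsep⟩ : ∃ δ > 0, ∀ i j, i ≠ j → ∀ x ∈ C i, ∀ y ∈ C j, δ < dist x y := by
    have hev : ∀ᶠ δ in nhdsWithin (0 : ℝ) (Ioi 0),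
        ∀ i j, i ≠ j → ∀ x ∈ C i, ∀ y ∈ C j, δ < dist x y := by
      rw [eventually_all]
      intro i
      rw [eventually_all]
      intro j
      by_cases hij : i = j
      · exact Eventually.of_forall fun _ h => absurd hij h
      obtain ⟨r, hr, hr'⟩ := Metric.exists_pos_forall_lt_edist (hC i) (hC j).isClosed (hdisj i j hij)
      filter_upwards [Ioo_mem_nhdsGT (show (0 : ℝ) < r from hr)] with δ hδ _ x hx y hy
      have := hr' x hx y hy
      rw [edist_nndist, ENNReal.coe_lt_coe] at this
      exact hδ.2.trans (by exact_mod_cast this)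
    obtain ⟨δ, h1, h2⟩ := (hev.and self_mem_nhdsWithin).exists
    exact ⟨δ, h2, h1⟩
  have hword : ∀ (m : ℕ) (w : ℕ → Fin K), ∃ x ∈ C (w 0), ∀ i ≤ m, f^[N * i] x ∈ C (w i) := by
    intro m
    induction m with
    | zero =>
      intro w
      obtain ⟨x, hx⟩ := hne (w 0)
      exact ⟨x, hx, fun i hi => by obtain rfl : i = 0 := by omega
                                   simpa using hx⟩
    | succ m ih =>
      intro w
      obtain ⟨y, hy, hy'⟩ := ih fun i => w (i + 1)
      obtain ⟨x, hx, rfl⟩ := hcov (w 0) _ hy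
      refine ⟨x, hx, fun i hi => ?_⟩
      cases i with
      | zero => simpa using hx
      | succ i =>
        rw [show N * (i + 1) = N * i + N by ring, iterate_add_apply]
        exact hy' i (by omega)
  -- Points following different words are more than `δ` apart at some time, so their dynamical balls
  -- of radius `δ / 2` are disjoint.
  refine ⟨{p | dist p.1 p.2 < δ / 2}, Metric.dist_mem_uniformity (half_pos hδ), fun m => ?_⟩
  have hpt : ∀ w : Fin m → Fin K, ∃ x, ∀ i : Fin m, f^[N * i] x ∈ C (w i) := by
    intro w
    obtain ⟨x, -, hx⟩ := hword m fun i => if h : i < m then w ⟨i, h⟩ else ⟨0, hK⟩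
    refine ⟨x, fun i => ?_⟩
    simpa using hx i i.2.le
  choose p hp using hpt
  have hfar : ∀ w w', w ≠ w' → ∃ k < N * m, δ < dist (f^[k] (p w)) (f^[k] (p w')) := by
    intro w w' hww
    obtain ⟨i, hi⟩ := Function.ne_iff.1 hww
    exact ⟨N * i, Nat.mul_lt_mul_of_pos_left i.2 hN, hsep _ _ hi _ (hp w i) _ (hp w' i)⟩
  have hinj : Injective p := by
    intro w w' he
    by_contra hww
    obtain ⟨k, -, hk⟩ := hfar w w' hww
    rw [he, dist_self] at hk
    linarith
  have hnet : Dynamics.IsDynNetIn f univ {p : X × X | dist p.1 p.2 < δ / 2} (N * m)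
      ((Finset.univ.image p : Finset X) : Set X) := by
    refine ⟨subset_univ _, ?_⟩
    rw [Finset.coe_image, Finset.coe_univ, image_univ]
    rintro _ ⟨w, rfl⟩ _ ⟨w', rfl⟩ hww
    rw [onFun, Set.disjoint_left]
    intro z hz hz'
    obtain ⟨k, hk, hk'⟩ := hfar w w' fun h => hww (by rw [h])
    have h1 := Dynamics.mem_dynEntourage.1 hz k hk
    have h2 := Dynamics.mem_dynEntourage.1 hz' k hk
    simp only [mem_ofPred_eq] at h1 h2
    linarith [dist_triangle_right (f^[k] (p w)) (f^[k] (p w')) (f^[k] z)]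
  refine le_trans (le_of_eq ?_) hnet.card_le_netMaxcard
  rw [Finset.card_image_of_injective _ hinj, Finset.card_univ, Fintype.card_fun, Fintype.card_fin,
    Fintype.card_fin]

theorem log_le_coverEntropy {X : Type*} [MetricSpace X] {f : X → X} {K N : ℕ} (hN : 0 < N)
    (hK : 0 < K) {C : Fin K → Set X} (hC : ∀ i, IsCompact (C i)) (hne : ∀ i, (C i).Nonempty)
    (hdisj : ∀ i j, i ≠ j → Disjoint (C i) (C j)) (hcov : ∀ i j, C j ⊆ f^[N] '' C i) :
    ((Real.log K / N : ℝ) : EReal) ≤ Dynamics.coverEntropy f univ := by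
  obtain ⟨U, hU, hle⟩ := pow_le_netMaxcard hN hK hC hne hdisj hcov
  refine le_trans ?_ (Dynamics.netEntropyEntourage_le_coverEntropy f univ hU)
  have hmono : Monotone fun n : ℕ => (Dynamics.netMaxcard f univ U n : ENNReal) :=
    fun _ _ h => ENat.toENNReal_mono (Dynamics.netMaxcard_monotone_time f univ U h)
  -- Monotonicity in time lets the growth rate along multiples of `N` be computed as `N` times the
  -- full rate.
  have h1 : ENNReal.log (K : ENNReal) ≤ (N : EReal) * Dynamics.netEntropyEntourage f univ U := by
    rw [Dynamics.netEntropyEntourage, ← hmono.expGrowthSup_comp_mul hN.ne',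
      ← ExpGrowth.expGrowthSup_pow]
    refine ExpGrowth.expGrowthSup_monotone fun m => ?_
    have := ENat.toENNReal_mono (hle m)
    simpa using this
  have h2 : ENNReal.log (K : ENNReal) = ((Real.log K : ℝ) : EReal) := by
    rw [← ENNReal.ofReal_natCast, ENNReal.log_ofReal_of_pos (by exact_mod_cast hK)]
  rw [h2] at h1
  rw [EReal.coe_div]
  exact (EReal.div_le_iff_le_mul (by exact_mod_cast hN) (EReal.coe_ne_top _)).2 h1

/-! ### Transfer between the interval and the real line -/

section Interval

variable {a b : ℝ} {f : Icc a b → Icc a b} {F : ℝ → ℝ}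

theorem DenseLiYorke.of_isDenselyChaotic (hfF : Semiconj Subtype.val f F)
    (h : IsDenselyChaotic f) : DenseLiYorke a b F := by
  intro s t s' t' h1 h2 h3 h4 h5 h6
  let V : Set (Icc a b × Icc a b) := {p | (p.1 : ℝ) ∈ Ioo s t ∧ (p.2 : ℝ) ∈ Ioo s' t'}
  have hVo : IsOpen V :=
    (isOpen_Ioo.preimage (continuous_subtype_val.comp continuous_fst)).inter
      (isOpen_Ioo.preimage (continuous_subtype_val.comp continuous_snd))
  have hVne : V.Nonempty := by
    obtain ⟨x, hx⟩ := exists_between h2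
    obtain ⟨y, hy⟩ := exists_between h5
    exact ⟨⟨⟨x, by linarith [hx.1], by linarith [hx.2]⟩, ⟨y, by linarith [hy.1], by linarith [hy.2]⟩⟩,
      hx, hy⟩
  obtain ⟨⟨x, y⟩, ⟨hx, hy⟩, δ, hδ, hsup, hinf⟩ := h.inter_open_nonempty V hVo hVne
  have hdist : ∀ n, edist (f^[n] x) (f^[n] y) = ENNReal.ofReal |F^[n] x - F^[n] y| := by
    intro n
    have hx' : ((f^[n] x : Icc a b) : ℝ) = F^[n] x := (hfF.iterate_right n) x
    have hy' : ((f^[n] y : Icc a b) : ℝ) = F^[n] y := (hfF.iterate_right n) y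
    rw [edist_dist, Subtype.dist_eq, Real.dist_eq, hx', hy']
  simp only [hdist] at hsup hinf
  refine ⟨x, ⟨hx.1.le, hx.2.le⟩, y, ⟨hy.1.le, hy.2.le⟩, fun ε hε => ?_, fun ht => ?_⟩
  · have : liminf (fun n : ℕ => ENNReal.ofReal |F^[n] x - F^[n] y|) atTop < ENNReal.ofReal ε := by
      rw [hinf]; exact ENNReal.ofReal_pos.2 hε
    exact (frequently_lt_of_liminf_lt isCobounded_ge_of_top this).mono fun n hn =>
      (ENNReal.ofReal_lt_ofReal_iff hε).1 hn
  · have h0 := (ENNReal.continuous_ofReal.tendsto |(0 : ℝ)|).comp ht.abs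
    rw [abs_zero, ENNReal.ofReal_zero] at h0
    have := h0.limsup_eq
    simp only [comp_def] at this
    rw [this] at hsup
    exact absurd hsup not_lt_zero

theorem IsDenselyChaotic.lt (hab : a ≤ b) (h : IsDenselyChaotic f) : a < b := by
  refine lt_of_le_of_ne hab ?_
  rintro rfl
  have : Nonempty (Icc a a × Icc a a) := ⟨⟨⟨a, le_rfl, le_rfl⟩, ⟨a, le_rfl, le_rfl⟩⟩⟩
  obtain ⟨⟨x, y⟩, δ, -, hsup, -⟩ := h.nonempty
  have : ∀ n, edist (f^[n] x) (f^[n] y) = 0 := fun n => by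
    rw [Subsingleton.elim (f^[n] x) (f^[n] y), edist_self]
  simp only [this, limsup_const] at hsup
  exact absurd hsup not_lt_zero

theorem RealHorseshoe.hasHorseshoe {n : ℕ} (hfF : Semiconj Subtype.val f F)
    (hF : ∀ x, F^[n] x ∈ Icc a b) (h : RealHorseshoe F^[n]) : HasHorseshoe (f^[n]) := by
  obtain ⟨c, d, c', d', h1, h2, h3, h4⟩ := h
  have hmem : ∀ x ∈ Icc c d ∪ Icc c' d', x ∈ Icc a b := fun x hx => by
    obtain ⟨⟨y, -, rfl⟩, -⟩ := h4 hx
    exact hF y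
  have hc := hmem c (Or.inl (left_mem_Icc.2 h1.le))
  have hd := hmem d (Or.inl (right_mem_Icc.2 h1.le))
  have hc' := hmem c' (Or.inr (left_mem_Icc.2 h3.le))
  have hd' := hmem d' (Or.inr (right_mem_Icc.2 h3.le))
  refine ⟨⟨c, hc⟩, ⟨d, hd⟩, ⟨c', hc'⟩, ⟨d', hd'⟩, h1, h3, ?_, fun x hx => ?_⟩
  · rw [Set.disjoint_left]
    intro x hx hx'
    have hxd : (x : ℝ) ≤ d := (interior_subset hx).2
    have hxc : c' ≤ (x : ℝ) := (interior_subset hx').1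
    have hmt : Subtype.val '' interior (Icc (⟨c, hc⟩ : Icc a b) ⟨d, hd⟩) ∈
        nhdsWithin (x : ℝ) (Icc a b) :=
      (mem_nhds_subtype_iff_nhdsWithin.1 (isOpen_interior.mem_nhds hx))
    have hle : nhdsWithin (x : ℝ) (Ioo x d') ≤ nhdsWithin (x : ℝ) (Icc a b) :=
      nhdsWithin_mono _ fun y hy => ⟨x.2.1.trans hy.1.le, hy.2.le.trans hd'.2⟩
    -- Interiors are relative to `[a, b]`. A common point would equal `d` and `c'`; as `d' ≤ b` lies
    -- to its right, so would some points of the first interior, which cannot exceed `d`.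
    have hxd' : (x : ℝ) < d' := by linarith
    rw [nhdsWithin_Ioo_eq_nhdsGT hxd'] at hle
    obtain ⟨_, ⟨y, hy, rfl⟩, hxy⟩ :=
      ((show ∀ᶠ y in nhdsWithin (x : ℝ) (Ioi x), _ from hle hmt).and self_mem_nhdsWithin).exists
    have hyd : (y : ℝ) ≤ d := (interior_subset hy).2
    have hxy' : (x : ℝ) < y := hxy
    linarith
  · have hx' : (x : ℝ) ∈ Icc c d ∪ Icc c' d' := hx
    obtain ⟨⟨s, hs, hsx⟩, t, ht, htx⟩ := h4 hx'
    refine ⟨⟨⟨s, hmem s (Or.inl hs)⟩, hs, Subtype.ext ?_⟩, ⟨t, hmem t (Or.inr ht)⟩, ht,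
      Subtype.ext ?_⟩
    · rw [← hsx]; exact (hfF.iterate_right n) _
    · rw [← htx]; exact (hfF.iterate_right n) _

theorem RealHorseshoe.log_two_div_two_le_coverEntropy (hcont : Continuous F)
    (hfF : Semiconj Subtype.val f F) (hF : ∀ x, F x ∈ Icc a b) (h : RealHorseshoe F^[2]) :
    ((Real.log 2 / 2 : ℝ) : EReal) ≤ Dynamics.coverEntropy f univ := by
  obtain ⟨lo, hi, hlh, hrange, hlev⟩ := h.exists_intervals (hcont.iterate 2)
  have hmem : ∀ x ∈ Icc lo hi, x ∈ Icc a b := fun x hx => by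
    obtain ⟨y, rfl⟩ := hrange hx
    exact hF (F y)
  -- Level `n + 1` has `2 ^ (n + 1)` intervals, half of which are kept, and takes `2 * (n + 1)`
  -- steps of `f`.
  have key : ∀ n : ℕ, ((Real.log 2 / 2 * (n / (n + 1)) : ℝ) : EReal) ≤
      Dynamics.coverEntropy f univ := by
    intro n
    obtain ⟨s, t, hst, hdisj⟩ := hlev (n + 1)
    obtain ⟨φ, hφ⟩ := exists_disjoint_Icc (M := 2 ^ n) (by simp [pow_succ']) (fun w => (hst w).2.1)
      hdisj
    have hsub : ∀ w x, x ∈ Icc (s w) (t w) → x ∈ Icc lo hi := fun w x hx =>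
      ⟨(hst w).1.trans hx.1, hx.2.trans (hst w).2.2.1⟩
    have := log_le_coverEntropy (f := f) (K := 2 ^ n) (N := 2 * (n + 1)) (by omega) (by positivity)
      (C := fun i => Subtype.val ⁻¹' Icc (s (φ i)) (t (φ i)))
      (fun i => (isClosed_Icc.preimage continuous_subtype_val).isCompact)
      (fun i => ⟨⟨s (φ i), hmem _ (hsub _ _ (left_mem_Icc.2 (hst _).2.1.le))⟩,
        left_mem_Icc.2 (hst _).2.1.le⟩)
      (fun i j hij => (hφ i j hij).preimage _) ?_
    · convert this using 2
      push_cast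
      rw [Real.log_pow]
      field_simp
    · intro i j x hx
      have hx' : (x : ℝ) ∈ Icc lo hi := hsub _ _ hx
      rw [← (hst (φ i)).2.2.2] at hx'
      obtain ⟨y, hy, hyx⟩ := hx'
      refine ⟨⟨y, hmem y (hsub _ _ hy)⟩, hy, Subtype.ext ?_⟩
      rw [← hyx, ← iterate_mul]
      exact (hfF.iterate_right _) _
  have hlim : Tendsto (fun n : ℕ => ((Real.log 2 / 2 * (n / (n + 1)) : ℝ) : EReal)) atTop
      (nhds ((Real.log 2 / 2 : ℝ) : EReal)) := by
    refine (continuous_coe_real_ereal.tendsto _).comp ?_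
    simpa using (tendsto_natCast_div_add_atTop (1 : ℝ)).const_mul (Real.log 2 / 2)
  exact le_of_tendsto' hlim key

theorem minimalPeriod_val (hfF : Semiconj Subtype.val f F) (x : Icc a b) :
    minimalPeriod F x = minimalPeriod f x := by
  rw [minimalPeriod_eq_minimalPeriod_iff]
  intro n
  have : ((f^[n] x : Icc a b) : ℝ) = F^[n] x := (hfF.iterate_right n) x
  simp only [IsPeriodicPt, IsFixedPt, ← this, Subtype.ext_iff]

theorem exists_minimalPeriod_iff (hfF : Semiconj Subtype.val f F) (hF : ∀ x, F x ∈ Icc a b)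
    {m : ℕ} (hm : 0 < m) : (∃ x, minimalPeriod F x = m) ↔ ∃ x, minimalPeriod f x = m := by
  constructor
  · rintro ⟨x, rfl⟩
    have hx : x ∈ Icc a b := by
      obtain ⟨k, hk⟩ := Nat.exists_eq_add_of_le' hm
      have := iterate_minimalPeriod (f := F) (x := x)
      rw [hk, iterate_succ_apply'] at this
      rw [← this]
      exact hF _
    exact ⟨⟨x, hx⟩, (minimalPeriod_val hfF ⟨x, hx⟩).symm⟩
  · rintro ⟨x, rfl⟩
    exact ⟨x, minimalPeriod_val hfF x⟩

theorem periodSet_val (hfF : Semiconj Subtype.val f F) (hF : ∀ x, F x ∈ Icc a b) :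
    periodSet f = periodSet F := by
  ext m
  exact and_congr_right fun hm => (exists_minimalPeriod_iff hfF hF hm).symm

end Interval

theorem corollary3p6 (a b : ℝ) (hab : a ≤ b) (f : Set.Icc a b → Set.Icc a b)
    (hf : Continuous f) (hchaos : IsDenselyChaotic f) :
    HasHorseshoe (f^[2]) ∧
      ((Real.log 2 / 2 : ℝ) : EReal) ≤ Dynamics.coverEntropy f Set.univ ∧
      IsOfSharkovskiiTypeAtMost f 6 ∧
      ∃ x : Set.Icc a b, Function.minimalPeriod f x = 6 := by
  -- All values of this extension lie in `[a, b]`, so its periodic points and horseshoes do too, and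
  -- belong to `f`.
  let F : ℝ → ℝ := fun x => f (projIcc a b hab x)
  have hcont : Continuous F := continuous_subtype_val.comp (hf.comp continuous_projIcc)
  have hF : ∀ x, F x ∈ Icc a b := fun x => (f (projIcc a b hab x)).2
  have hfF : Semiconj Subtype.val f F := fun x => by simp [F]
  have hhs : RealHorseshoe F^[2] :=
    (DenseLiYorke.of_isDenselyChaotic hfF hchaos).realHorseshoe_iterate_two hcont
      (hchaos.lt hab) hF
  refine ⟨hhs.hasHorseshoe hfF fun x => hF (F x), hhs.log_two_div_two_le_coverEntropy hcont hfF hF,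
    ?_, ?_⟩
  · obtain ⟨n, hn, hn0, hn'⟩ := isOfSharkovskiiTypeAtMost_six_of_real hab hcont hF hhs
    exact ⟨n, hn, hn0, (periodSet_val hfF hF).trans hn'⟩
  · exact (exists_minimalPeriod_iff hfF hF (by omega)).1
      (exists_even_period hcont hF hhs (m := 3) (by omega))
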